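/- We work over $\mathbb C$. A germ $(C,\mathbf 0)$ of a plane curve is called a $t_m$-singularity if it consists of $m$ smooth local branches and each pair of these branches has intersection number $2$; the common tangent line of the branches is called the tangent line to $C$ at that point. Fix a point $A\in\mathbb P^2$ and a line $\Lambda\subset\mathbb P^2$ passing through $A$. (1) Let $(x,y)$ be affine coordinates of $\mathbb P^2$ such that $A=(0,0)$ and $\Lambda=\{y=0\}$, let $m\ge 1$ and $d\ge 2m$, and let $C\subset\mathbb P^2$ be the plane curve of degree $d$ defined by $f(x,y)=\sum_{\mu+\nu\le d}a_{\mu\nu}x^\mu y^\nu=0$. Then $C$ has a $t_m$-singularity at $A$ with tangent line $\Lambda$ if and only if the following two conditions hold: (i) $a_{\mu\nu}=0$ whenever $\mu+2\nu<2m$; and (ii) the equation $$a_{0,m}z^m+a_{2,m-1}z^{m-1}+\dots+a_{2m-2,1}z+a_{2m,0}=0$$ has exactly $m$ distinct roots $z\in\mathbb C$. (2) A reduced plane curve $C\subset\mathbb P^2$ of degree $6$ is called a $t_3$-sextic in the frame $(A,\Lambda)$ if the singular locus of $C$ consists of the single point $A$ and $C$ has a $t_3$-singularity at $A$ with tangent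 line $\Lambda$. The set of all $t_3$-sextics in the frame $(A,\Lambda)$ is a non-empty Zariski open subset of a $15$-dimensional linear subspace of $|\mathcal O_{\mathbb P^2}(6)|$. -/

import Mathlib

noncomputable section

namespace PlaneCurveGerm

/-- The ring of formal power series `ℂ⟦x, y⟧`, the completed local ring of the affine plane at the
origin. The variable `0` is `x` and the variable `1` is `y`. -/
abbrev Series : Type := MvPowerSeries (Fin 2) ℂ

/-- The coefficient of `x` in `g`. -/
def coeffX (g : Series) : ℂ := MvPowerSeries.coeff (Finsupp.single 0 1) g

/-- The coefficient of `y` in `g`. -/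
def coeffY (g : Series) : ℂ := MvPowerSeries.coeff (Finsupp.single 1 1) g

/-- `g = 0` is a smooth local branch at the origin: `g` vanishes at the origin, and its linear
part is not zero. -/
def IsSmoothBranch (g : Series) : Prop :=
  MvPowerSeries.constantCoeff g = 0 ∧ (coeffX g ≠ 0 ∨ coeffY g ≠ 0)

/-- The tangent line at the origin of the smooth local branch `g = 0`: the zero set of the linear
part of `g`. -/
def tangentLine (g : Series) : Submodule ℂ (Fin 2 → ℂ) :=
  LinearMap.ker (coeffX g • LinearMap.proj (R := ℂ) (φ := fun _ : Fin 2 => ℂ) 0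
    + coeffY g • LinearMap.proj (R := ℂ) (φ := fun _ : Fin 2 => ℂ) 1)

/-- The line `y = 0`. -/
def xAxis : Submodule ℂ (Fin 2 → ℂ) :=
  LinearMap.ker (LinearMap.proj (R := ℂ) (φ := fun _ : Fin 2 => ℂ) 1)

/-- The local intersection number at the origin, `dim_ℂ ℂ⟦x, y⟧ / (g, h)`
(the value `0` is also taken when the dimension is infinite). -/
def intersectionNumber (g h : Series) : ℕ :=
  Module.finrank ℂ (Series ⧸ Ideal.span {g, h})

/-- The germ `f = 0` is a `t_m`-singularity whose tangent line is `T`: up to a unit, `f` is the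
product of `m` smooth local branches, each pair of branches has intersection number `2`, and `T` is
the common tangent line of the branches. -/
def IsTmGerm (m : ℕ) (f : Series) (T : Submodule ℂ (Fin 2 → ℂ)) : Prop :=
  ∃ (u : Seriesˣ) (g : Fin m → Series),
    f = u * ∏ i, g i ∧
    (∀ i, IsSmoothBranch (g i)) ∧
    (∀ i j, i ≠ j → intersectionNumber (g i) (g j) = 2) ∧
    (∀ i, tangentLine (g i) = T)

end PlaneCurveGerm

namespace PlaneCurve

/-- The space of ternary forms of degree `d`, that is `H⁰(ℙ², 𝒪(d))`. -/
abbrev Forms (d : ℕ) : Submodule ℂ (MvPolynomial (Fin 3) ℂ) :=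
  MvPolynomial.homogeneousSubmodule (Fin 3) ℂ d

/-- The basis `e` of `ℂ³` gives the affine chart `(x, y) ↦ [e₀ + x e₁ + y e₂]` of `ℙ²`. In this
chart, `A` is the origin and `Λ` is the line `y = 0`. Lines of `ℙ²` are given as
two-dimensional subspaces of `ℂ³`. -/
def IsAdapted (e : Module.Basis (Fin 3) ℂ (Fin 3 → ℂ))
    (A : Projectivization ℂ (Fin 3 → ℂ)) (Λ : Submodule ℂ (Fin 3 → ℂ)) : Prop :=
  A.submodule = Submodule.span ℂ {e 0} ∧ Λ = Submodule.span ℂ {e 0, e 1}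

/-- The affine equation `f(x, y) = F(e₀ + x e₁ + y e₂)` of the curve `F = 0` in the affine chart
given by `e`. -/
def affineEquation (e : Module.Basis (Fin 3) ℂ (Fin 3 → ℂ)) (F : MvPolynomial (Fin 3) ℂ) :
    MvPolynomial (Fin 2) ℂ :=
  MvPolynomial.aeval (fun i => MvPolynomial.C (e 0 i) + MvPolynomial.C (e 1 i) * MvPolynomial.X 0
    + MvPolynomial.C (e 2 i) * MvPolynomial.X 1) F

/-- The coefficient `a_{μν}` of `x^μ y^ν` in the affine equation of the curve `F = 0`. -/
def affineCoeff (e : Module.Basis (Fin 3) ℂ (Fin 3 → ℂ)) (F : MvPolynomial (Fin 3) ℂ)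
    (μ ν : ℕ) : ℂ :=
  MvPolynomial.coeff (Finsupp.single 0 μ + Finsupp.single 1 ν) (affineEquation e F)

/-- The plane curve `F = 0` has a `t_m`-singularity at the point `A` of `ℙ²`, with tangent line
`Λ` there: this is read off in affine coordinates with `A = (0, 0)` and `Λ = {y = 0}`. -/
def HasTmSingularity (m : ℕ) (F : MvPolynomial (Fin 3) ℂ)
    (A : Projectivization ℂ (Fin 3 → ℂ)) (Λ : Submodule ℂ (Fin 3 → ℂ)) : Prop :=
  ∃ e : Module.Basis (Fin 3) ℂ (Fin 3 → ℂ), IsAdapted e A Λ ∧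
    PlaneCurveGerm.IsTmGerm m (affineEquation e F : MvPowerSeries (Fin 2) ℂ) PlaneCurveGerm.xAxis

/-- The singular locus in `ℙ²` of the curve `F = 0`. -/
def singularLocus (F : MvPolynomial (Fin 3) ℂ) : Set (Projectivization ℂ (Fin 3 → ℂ)) :=
  {P | MvPolynomial.eval P.rep F = 0 ∧ ∀ i, MvPolynomial.eval P.rep (MvPolynomial.pderiv i F) = 0}

/-- The (reduced) plane curve `F = 0` of degree `6` is a `t_3`-sextic in the frame `(A, Λ)`: its
singular locus is the point `A`, where it has a `t_3`-singularity with tangent line `Λ`. -/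
structure IsT3Sextic (F : MvPolynomial (Fin 3) ℂ)
    (A : Projectivization ℂ (Fin 3 → ℂ)) (Λ : Submodule ℂ (Fin 3 → ℂ)) : Prop where
  isHomogeneous : F.IsHomogeneous 6
  squarefree : Squarefree F
  singularLocus_eq : singularLocus F = {A}
  hasTmSingularity : HasTmSingularity 3 F A Λ

/-- The set of all `t_3`-sextics in the frame `(A, Λ)`, as a subset of the complete linear system
`|𝒪(6)|`, which is the projective space of the vector space of ternary forms of degree `6`. -/
def t3Sextics (A : Projectivization ℂ (Fin 3 → ℂ)) (Λ : Submodule ℂ (Fin 3 → ℂ)) :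
    Set (Projectivization ℂ (Forms 6)) :=
  {C | IsT3Sextic (C.rep : MvPolynomial (Fin 3) ℂ) A Λ}

/-- The linear subspace of the projective space of `W` given by a vector subspace `L` of `W`. It has
dimension `dim L - 1`. -/
def projSubspace {W : Type*} [AddCommGroup W] [Module ℂ W] (L : Submodule ℂ W) :
    Set (Projectivization ℂ W) :=
  {x | x.submodule ≤ L}

/-- Zariski open subsets of the projective space of `W`: complements of the common zero sets of
homogeneous polynomials in linear forms on `W`. -/
def IsZariskiOpen {W : Type*} [AddCommGroup W] [Module ℂ W] (U : Set (Projectivization ℂ W)) :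
    Prop :=
  ∃ S : Set (MvPolynomial (Module.Dual ℂ W) ℂ), (∀ P ∈ S, ∃ n : ℕ, P.IsHomogeneous n) ∧
    U = {x | ∀ P ∈ S, MvPolynomial.eval (fun φ : Module.Dual ℂ W => φ x.rep) P = 0}ᶜ

end PlaneCurve

end

noncomputable section

open PlaneCurveGerm PlaneCurve

/-! Give `x` weight 1 and `y` weight 2. On the parabola `x = t`, `y = z t²` a monomial becomes `z^ν
t^(μ+2ν)`, so for varying `z` the coefficient of `t^k` records exactly the part of weight `k`.
Condition (i) says that `f` vanishes to order `2m` along all these parabolas, and the polynomial in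
(ii) is the coefficient of `t^(2m)` (`tmConditions_seriesCoeff_iff`).

For (1), a smooth branch tangent to `y = 0` is, up to a unit, `y = x²(c + ⋯)`, and two such branches
have intersection number 2 exactly when their values of `c` differ. A product of `m` branches
therefore has a leading coefficient with the numbers `c` as its roots (`tmConditions_of_isTmGerm`).
Conversely, the simple roots in (ii) lift by Hensel's lemma to power series `ζ` with `f(x, x²ζ) =
0`, and the factors `y - x²ζ` split off from `f`, leaving a unit (`isTmGerm_of_tmConditions`).
Changes of adapted frame respect the weight filtration (`TmConditions.of_isAdapted`), so any adapted
frame may be used.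

For (2), condition (i) with `m = 3` cuts out a space of forms of dimension 16. Within it, being a
`t₃`-sextic means that the strict transform under the weighted blowup with weights (1, 2) is smooth
off the exceptional curve and meets that curve transversally (`isT3Sextic_iff_isStrictlySmooth`). In
the Cox ring this says that a bihomogeneous system, linear in the coefficients of the sextic, has no
zero outside the irrelevant locus. By the Nullstellensatz this happens exactly when the ideal of the
system contains all monomials of some bidegree `(3N, 2N)`, which is expressed by nonvanishing of
determinants of linear forms (`isStrictlySmooth_iff_exists_det_ne_zero`). Hence the condition is
open, and one explicit sextic shows that it is not empty. -/

/-! ### Restriction to parabolas and the weight filtration -/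

lemma hasSubst_parabola (z : ℂ) : MvPowerSeries.HasSubst (S := ℂ) (τ := Unit)
    (![PowerSeries.X, PowerSeries.C z * PowerSeries.X ^ 2] : Fin 2 → PowerSeries ℂ) := by
  refine MvPowerSeries.hasSubst_of_constantCoeff_zero ?_
  intro s
  change PowerSeries.constantCoeff _ = 0
  fin_cases s <;> simp

/-- The restriction of a power series to the parabola `x = t`, `y = z * t ^ 2`. -/
def alongParabola (z : ℂ) : Series →ₐ[ℂ] PowerSeries ℂ :=
  MvPowerSeries.substAlgHom (hasSubst_parabola z)

lemma coeff_alongParabola (z : ℂ) (f : Series) (k : ℕ) :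
    PowerSeries.coeff k (alongParabola z f) = ∑ j ∈ Finset.range (k / 2 + 1),
      MvPowerSeries.coeff (Finsupp.single 0 (k - 2 * j) + Finsupp.single 1 j) f * z ^ j := by
  rw [alongParabola, MvPowerSeries.substAlgHom_apply, PowerSeries.coeff,
    MvPowerSeries.coeff_subst (hasSubst_parabola z)]
  have key : ∀ d : Fin 2 →₀ ℕ, MvPowerSeries.coeff (R := ℂ) (Finsupp.single () k)
      (d.prod fun s e => ((![PowerSeries.X, PowerSeries.C z * PowerSeries.X ^ 2] :
        Fin 2 → PowerSeries ℂ) s) ^ e) = if d 0 + 2 * d 1 = k then z ^ d 1 else 0 := by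
    intro d
    rw [Finsupp.prod_fintype _ _ (by simp)]
    change PowerSeries.coeff k _ = _
    simp only [Fin.prod_univ_two, Matrix.cons_val_zero, Matrix.cons_val_one]
    rw [mul_pow, ← pow_mul, mul_left_comm, ← pow_add, ← map_pow, PowerSeries.coeff_C_mul,
      PowerSeries.coeff_X_pow]
    simp [eq_comm]
  simp only [key]
  rw [finsum_eq_sum_of_support_subset (s := (Finset.range (k / 2 + 1)).image
    (fun j => (Finsupp.single 0 (k - 2 * j) + Finsupp.single 1 j : Fin 2 →₀ ℕ)))]
  · rw [Finset.sum_image]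
    · refine Finset.sum_congr rfl fun j hj => ?_
      rw [Finset.mem_range] at hj
      rw [if_pos (by simp; omega)]
      simp
    · intro i _ j _ h
      simpa using DFunLike.congr_fun h 1
  · intro d hd
    simp only [Function.mem_support, ne_eq, smul_eq_mul, mul_ite, mul_zero, ite_eq_right_iff,
      Classical.not_imp] at hd
    simp only [Finset.coe_image, Set.mem_image, Finset.coe_range, Set.mem_Iio]
    refine ⟨d 1, by omega, ?_⟩
    ext s
    fin_cases s <;> simp
    omega

/-- The conditions on the coefficients of `∑ a μ ν x^μ y^ν` that characterize a `t_m`-singularity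
with tangent line `y = 0`. -/
def TmConditions (m : ℕ) (a : ℕ → ℕ → ℂ) : Prop :=
  (∀ μ ν : ℕ, μ + 2 * ν < 2 * m → a μ ν = 0) ∧
    {z : ℂ | ∑ p ∈ Finset.HasAntidiagonal.antidiagonal m, a (2 * p.1) p.2 * z ^ p.2 = 0}.encard = m

/-- The coefficient of `x ^ μ * y ^ ν`. -/
def seriesCoeff (f : Series) (μ ν : ℕ) : ℂ :=
  MvPowerSeries.coeff (Finsupp.single 0 μ + Finsupp.single 1 ν) f

lemma coeff_alongParabola' (z : ℂ) (f : Series) (k : ℕ) :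
    PowerSeries.coeff k (alongParabola z f) = ∑ j ∈ Finset.range (k / 2 + 1),
      seriesCoeff f (k - 2 * j) j * z ^ j := coeff_alongParabola z f k

lemma coeff_eq_zero_of_sum_mul_pow_eq_zero {n : ℕ} {c : ℕ → ℂ}
    (h : ∀ z : ℂ, ∑ j ∈ Finset.range n, c j * z ^ j = 0) {j : ℕ} (hj : j < n) : c j = 0 := by
  have : (∑ j ∈ Finset.range n, Polynomial.monomial j (c j)) = 0 := by
    refine Polynomial.funext fun z => ?_
    simpa [Polynomial.eval_finsetSum] using h z
  have h2 := congrArg (Polynomial.coeff · j) this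
  simpa [Polynomial.finsetSum_coeff, Polynomial.coeff_monomial, hj] using h2

/-- The coefficient of `t^k` is a polynomial in `z` whose coefficients are the `a μ ν` of weight
`k`; it vanishes for every `z` only if all of these do. For `k = 2m` it is the polynomial of
condition (ii). -/
lemma tmConditions_seriesCoeff_iff (m : ℕ) (f : Series) :
    TmConditions m (seriesCoeff f) ↔
      (∀ z k, k < 2 * m → PowerSeries.coeff k (alongParabola z f) = 0) ∧
      {z : ℂ | PowerSeries.coeff (2 * m) (alongParabola z f) = 0}.encard = m := by
  have h2 : ∀ z, PowerSeries.coeff (2 * m) (alongParabola z f) =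
      ∑ p ∈ Finset.HasAntidiagonal.antidiagonal m, seriesCoeff f (2 * p.1) p.2 * z ^ p.2 := by
    intro z
    rw [coeff_alongParabola', ← Finset.Nat.sum_antidiagonal_swap,
      Finset.Nat.sum_antidiagonal_eq_sum_range_succ_mk]
    simp [Nat.mul_sub]
  simp only [TmConditions, h2]
  refine and_congr_left fun _ => ⟨fun h z k hk => ?_, fun h μ ν hμ => ?_⟩
  · rw [coeff_alongParabola']
    refine Finset.sum_eq_zero fun j hj => ?_
    rw [Finset.mem_range] at hj
    rw [h _ _ (by omega), zero_mul]
  · have := coeff_eq_zero_of_sum_mul_pow_eq_zero (n := (μ + 2 * ν) / 2 + 1)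
      (c := fun j => seriesCoeff f (μ + 2 * ν - 2 * j) j)
      (fun z => by rw [← coeff_alongParabola', h z _ hμ]) (j := ν) (by omega)
    simpa using this

/-! ### From branches to coefficient conditions -/

lemma coeffX_eq_zero_of_tangentLine {g : Series} (h : tangentLine g = xAxis) : coeffX g = 0 := by
  have : (![1, 0] : Fin 2 → ℂ) ∈ tangentLine g := by rw [h]; simp [xAxis]
  simpa [tangentLine] using this

lemma tangentLine_eq_xAxis {g : Series} (hx : coeffX g = 0) (hy : coeffY g ≠ 0) :
    tangentLine g = xAxis := by
  ext v
  simp [tangentLine, xAxis, hx, hy]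

lemma coeff_zero_alongParabola (z : ℂ) (g : Series) :
    PowerSeries.coeff 0 (alongParabola z g) = MvPowerSeries.constantCoeff g := by
  simp [coeff_alongParabola]

lemma coeff_one_alongParabola (z : ℂ) (g : Series) :
    PowerSeries.coeff 1 (alongParabola z g) = coeffX g := by
  simp [coeff_alongParabola, coeffX]

lemma coeff_two_alongParabola (z : ℂ) (g : Series) :
    PowerSeries.coeff 2 (alongParabola z g) = seriesCoeff g 2 0 + coeffY g * z := by
  rw [coeff_alongParabola', show 2 / 2 + 1 = 2 from rfl, Finset.sum_range_succ,
    Finset.sum_range_one, show 2 - 2 * 0 = 2 from rfl, show 2 - 2 * 1 = 0 from rfl]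
  simp [coeffY, seriesCoeff]

lemma alongParabola_X0 (z : ℂ) : alongParabola z (MvPowerSeries.X 0) = PowerSeries.X := by
  rw [alongParabola, MvPowerSeries.substAlgHom_X]; rfl

lemma alongParabola_X1 (z : ℂ) : alongParabola z (MvPowerSeries.X 1) =
    PowerSeries.C z * PowerSeries.X ^ 2 := by
  rw [alongParabola, MvPowerSeries.substAlgHom_X]; rfl

/-- Branches that agree to order two along a parabola have intersection number greater than two. -/
lemma intersectionNumber_ne_two {g h : Series} (z : ℂ)
    (hg : ∀ k < 3, PowerSeries.coeff k (alongParabola z g) = 0)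
    (hh : ∀ k < 3, PowerSeries.coeff k (alongParabola z h) = 0) : intersectionNumber g h ≠ 2 := by
  intro H
  rw [intersectionNumber] at H
  set I : Ideal Series := Ideal.span {g, h}
  -- The first three coefficients along the parabola kill the ideal, and `1, x, x²` already map onto
  -- a basis, so the quotient has at least three dimensions if it is finite-dimensional.
  let T : Series →ₗ[ℂ] (Fin 3 → ℂ) :=
    LinearMap.pi fun k => (PowerSeries.coeff (k : ℕ)).comp (alongParabola z).toLinearMap
  have hT : I.restrictScalars ℂ ≤ LinearMap.ker T := by
    intro f hf
    have hdvd : (PowerSeries.X ^ 3 : PowerSeries ℂ) ∣ alongParabola z f := by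
      obtain ⟨a, b, rfl⟩ := Ideal.mem_span_pair.1 (show f ∈ I from hf)
      rw [map_add, map_mul, map_mul]
      exact dvd_add (Dvd.dvd.mul_left (PowerSeries.X_pow_dvd_iff.2 hg) _)
        (Dvd.dvd.mul_left (PowerSeries.X_pow_dvd_iff.2 hh) _)
    rw [LinearMap.mem_ker]
    ext k
    exact PowerSeries.X_pow_dvd_iff.1 hdvd k k.2
  have hs : Function.Surjective T := by
    intro v
    refine ⟨algebraMap ℂ _ (v 0) + algebraMap ℂ _ (v 1) * MvPowerSeries.X 0
      + algebraMap ℂ _ (v 2) * MvPowerSeries.X 0 ^ 2, ?_⟩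
    ext k
    simp only [T, LinearMap.pi_apply, LinearMap.comp_apply, AlgHom.toLinearMap_apply, map_add,
      map_mul, map_pow, alongParabola_X0, AlgHom.commutes, PowerSeries.algebraMap_apply,
      Algebra.algebraMap_self, RingHom.id_apply, PowerSeries.coeff_C_mul, PowerSeries.coeff_X_pow,
      PowerSeries.coeff_C, PowerSeries.coeff_X]
    fin_cases k <;> simp
  have hs' : Function.Surjective ((I.restrictScalars ℂ).liftQ T hT) := by
    rw [← LinearMap.range_eq_top, Submodule.range_liftQ, LinearMap.range_eq_top]
    exact hs
  rw [← (Submodule.Quotient.restrictScalarsEquiv ℂ I).finrank_eq] at H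
  -- The value 2 is not the default value 0 of `finrank`, so the quotient is finite-dimensional and
  -- dimensions can be compared.
  have : Module.Finite ℂ (Series ⧸ I.restrictScalars ℂ) :=
    Module.finite_of_finrank_pos (by omega)
  have := LinearMap.finrank_le_finrank_of_surjective hs'
  simp only [Module.finrank_fin_fun] at this
  omega

/-- Along the parabola each branch equals `t²` times a series whose constant term is linear in `z`
with nonzero slope. The leading coefficient of the product is thus a nonzero constant times `m`
linear factors, one for each branch. Two equal roots would give two branches that both meet one
parabola to order three, against intersection number 2. -/
theorem tmConditions_of_isTmGerm {m : ℕ} {f : Series} (hf : IsTmGerm m f xAxis) :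
    TmConditions m (seriesCoeff f) := by
  obtain ⟨u, g, rfl, hsm, hint, htan⟩ := hf
  have hX : ∀ i, coeffX (g i) = 0 := fun i => coeffX_eq_zero_of_tangentLine (htan i)
  have hY : ∀ i, coeffY (g i) ≠ 0 := fun i => by
    have := (hsm i).2
    simpa [hX i] using this
  have hdvd : ∀ z i, ∃ w : PowerSeries ℂ, alongParabola z (g i) = PowerSeries.X ^ 2 * w ∧
      PowerSeries.constantCoeff w = seriesCoeff (g i) 2 0 + coeffY (g i) * z := by
    intro z i
    have : (PowerSeries.X ^ 2 : PowerSeries ℂ) ∣ alongParabola z (g i) := by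
      refine PowerSeries.X_pow_dvd_iff.2 fun k hk => ?_
      interval_cases k
      · rw [coeff_zero_alongParabola, (hsm i).1]
      · rw [coeff_one_alongParabola, hX i]
    obtain ⟨w, hw⟩ := this
    refine ⟨w, hw, ?_⟩
    rw [← coeff_two_alongParabola, hw, PowerSeries.coeff_X_pow_mul', if_pos le_rfl]
    simp
  choose w hw hw0 using hdvd
  have hfw : ∀ z, alongParabola z (u * ∏ i, g i) =
      PowerSeries.X ^ (2 * m) * (alongParabola z u * ∏ i, w z i) := by
    intro z
    rw [map_mul, map_prod, Finset.prod_congr rfl fun i _ => hw z i, Finset.prod_mul_distrib]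
    simp only [Finset.prod_const, Finset.card_univ, Fintype.card_fin]
    ring
  have hu : MvPowerSeries.constantCoeff (u : Series) ≠ 0 :=
    (MvPowerSeries.isUnit_iff_constantCoeff.1 u.isUnit).ne_zero
  rw [tmConditions_seriesCoeff_iff]
  refine ⟨fun z k hk => ?_, ?_⟩
  · rw [hfw, PowerSeries.coeff_X_pow_mul', if_neg (by omega)]
  · have : {z : ℂ | PowerSeries.coeff (2 * m) (alongParabola z (u * ∏ i, g i)) = 0} =
        Set.range fun i => -seriesCoeff (g i) 2 0 / coeffY (g i) := by
      ext z
      rw [Set.mem_ofPred_eq, hfw, PowerSeries.coeff_X_pow_mul', if_pos le_rfl, Nat.sub_self,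
        PowerSeries.coeff_zero_eq_constantCoeff_apply, map_mul, map_prod,
        ← PowerSeries.coeff_zero_eq_constantCoeff_apply, coeff_zero_alongParabola,
        mul_eq_zero, or_iff_right hu, Finset.prod_eq_zero_iff, Set.mem_range]
      simp only [Finset.mem_univ, true_and, hw0]
      refine exists_congr fun i => ?_
      rw [div_eq_iff (hY i)]
      constructor <;> intro h <;> linear_combination -h
    rw [this, ← Set.image_univ, Set.InjOn.encard_image]
    · simp
    intro i _ j _ hij
    by_contra hne
    refine intersectionNumber_ne_two (-seriesCoeff (g i) 2 0 / coeffY (g i)) ?_ ?_ (hint i j hne)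
    · intro k hk
      interval_cases k
      · rw [coeff_zero_alongParabola, (hsm i).1]
      · rw [coeff_one_alongParabola, hX i]
      · rw [coeff_two_alongParabola]; field_simp [hY i]; ring
    · intro k hk
      interval_cases k
      · rw [coeff_zero_alongParabola, (hsm j).1]
      · rw [coeff_one_alongParabola, hX j]
      · rw [coeff_two_alongParabola]
        simp only at hij
        rw [hij]; field_simp [hY j]; ring

/-! ### Hensel lifting and the factorization into branches -/

lemma PowerSeries.constantCoeff_polynomial_eval (h : Polynomial (PowerSeries ℂ)) (c : PowerSeries ℂ) :
    PowerSeries.constantCoeff (h.eval c) =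
      (h.map (PowerSeries.constantCoeff (R := ℂ))).eval (PowerSeries.constantCoeff c) := by
  rw [Polynomial.eval_map, Polynomial.eval₂_at_apply]

/-- Hensel's lemma for `ℂ⟦X⟧`, for polynomials that need not be monic. -/
lemma PowerSeries.exists_eval_eq_zero (h : Polynomial (PowerSeries ℂ)) (c : ℂ)
    (h0 : (h.map (PowerSeries.constantCoeff (R := ℂ))).eval c = 0)
    (h1 : (h.map (PowerSeries.constantCoeff (R := ℂ))).derivative.eval c ≠ 0) :
    ∃ ζ : PowerSeries ℂ, PowerSeries.constantCoeff ζ = c ∧ h.eval ζ = 0 := by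
  -- Newton iteration with the inverse derivative frozen at `c`: each step gains one power of `X`,
  -- which is enough for convergence.
  set κ : ℂ := ((h.map (PowerSeries.constantCoeff (R := ℂ))).derivative.eval c)⁻¹
  let s : ℕ → PowerSeries ℂ := fun n =>
    Nat.rec (PowerSeries.C c) (fun _ b => b - h.eval b * PowerSeries.C κ) n
  have hs : ∀ n, s (n + 1) = s n - h.eval (s n) * PowerSeries.C κ := fun n => rfl
  have key : ∀ n, PowerSeries.constantCoeff (s n) = c ∧
      (PowerSeries.X ^ (n + 1) : PowerSeries ℂ) ∣ h.eval (s n) := by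
    intro n
    induction n with
    | zero =>
      have hc : PowerSeries.constantCoeff (s 0) = c := by simp [s]
      refine ⟨hc, ?_⟩
      rw [zero_add, pow_one, PowerSeries.X_dvd_iff, PowerSeries.constantCoeff_polynomial_eval, hc, h0]
    | succ n ih =>
      obtain ⟨hc, hd⟩ := ih
      have hz : PowerSeries.constantCoeff (h.eval (s n)) = 0 := by
        rw [PowerSeries.constantCoeff_polynomial_eval, hc, h0]
      refine ⟨by rw [hs]; simp [hc, hz], ?_⟩
      obtain ⟨k, hk⟩ := h.binomExpansion (s n) (-(h.eval (s n) * PowerSeries.C κ))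
      rw [hs, sub_eq_add_neg, hk]
      have hX : (PowerSeries.X : PowerSeries ℂ) ∣ 1 - h.derivative.eval (s n) * PowerSeries.C κ := by
        rw [PowerSeries.X_dvd_iff, map_sub, map_mul, PowerSeries.constantCoeff_polynomial_eval, hc,
          ← Polynomial.derivative_map, PowerSeries.constantCoeff_C, map_one, mul_inv_cancel₀ h1,
          sub_self]
      have e : h.eval (s n) + h.derivative.eval (s n) * -(h.eval (s n) * PowerSeries.C κ) +
          k * (-(h.eval (s n) * PowerSeries.C κ)) ^ 2 =
          h.eval (s n) * (1 - h.derivative.eval (s n) * PowerSeries.C κ) +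
          h.eval (s n) * h.eval (s n) * (k * PowerSeries.C κ ^ 2) := by ring
      rw [e]
      refine dvd_add (by rw [pow_succ]; exact mul_dvd_mul hd hX) (Dvd.dvd.mul_right ?_ _)
      rw [pow_succ]
      exact mul_dvd_mul hd (PowerSeries.X_dvd_iff.2 hz)
  have hstep : ∀ n k, (PowerSeries.X ^ (n + 1) : PowerSeries ℂ) ∣ s (n + k) - s n := by
    intro n k
    induction k with
    | zero => simp
    | succ k ih =>
      have : s (n + k) - h.eval (s (n + k)) * PowerSeries.C κ - s n =
        (s (n + k) - s n) - h.eval (s (n + k)) * PowerSeries.C κ := by ring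
      rw [← add_assoc, hs, this]
      exact dvd_sub ih (((pow_dvd_pow _ (by omega)).trans (key (n + k)).2).mul_right _)
  -- By `hstep` the coefficient of `X^n` no longer changes after `s n`, so the limit is read off
  -- diagonally.
  let ζ : PowerSeries ℂ := PowerSeries.mk fun n => PowerSeries.coeff n (s n)
  have hζ : ∀ n, (PowerSeries.X ^ (n + 1) : PowerSeries ℂ) ∣ ζ - s n := by
    intro n
    rw [PowerSeries.X_pow_dvd_iff]
    intro k hk
    obtain ⟨l, rfl⟩ := Nat.exists_eq_add_of_le (Nat.le_of_lt_succ hk)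
    have := PowerSeries.X_pow_dvd_iff.1 (hstep k l) k (Nat.lt_succ_self k)
    rw [map_sub, sub_eq_zero] at this
    simp [ζ, this]
  refine ⟨ζ, ?_, ?_⟩
  · rw [← PowerSeries.coeff_zero_eq_constantCoeff_apply, PowerSeries.coeff_mk,
      PowerSeries.coeff_zero_eq_constantCoeff_apply, (key 0).1]
  · ext n
    have h2 : (PowerSeries.X ^ (n + 1) : PowerSeries ℂ) ∣ h.eval ζ := by
      have := dvd_add ((hζ n).trans (Polynomial.sub_dvd_eval_sub ζ (s n) h)) (key n).2
      simpa using this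
    simpa using PowerSeries.X_pow_dvd_iff.1 h2 n (Nat.lt_succ_self n)

lemma mem_span_X_sq_iff (f : Series) :
    f ∈ Ideal.span {(MvPowerSeries.X 0 : Series) ^ 2, MvPowerSeries.X 1} ↔
      MvPowerSeries.constantCoeff f = 0 ∧ coeffX f = 0 := by
  have hψ : MvPowerSeries.constantCoeff f = 0 ∧ coeffX f = 0 ↔
      (PowerSeries.X ^ 2 : PowerSeries ℂ) ∣ alongParabola 0 f := by
    rw [PowerSeries.X_pow_dvd_iff]
    refine ⟨fun h k hk => ?_, fun h => ⟨?_, ?_⟩⟩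
    · interval_cases k
      · rw [coeff_zero_alongParabola, h.1]
      · rw [coeff_one_alongParabola, h.2]
    · rw [← coeff_zero_alongParabola 0, h 0 (by norm_num)]
    · rw [← coeff_one_alongParabola 0, h 1 (by norm_num)]
  rw [hψ]
  constructor
  · intro hf
    obtain ⟨a, b, rfl⟩ := Ideal.mem_span_pair.1 hf
    rw [map_add, map_mul, map_mul, map_pow, alongParabola_X0, alongParabola_X1]
    simp
  · intro h
    have hc := hψ.2 h
    -- `b` collects the terms free of `y`; the rest is divisible by `y`, and `b` is divisible by
    -- `x²`.
    let b : Series := fun n => if n 1 = 0 then MvPowerSeries.coeff n f else 0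
    have hb : ∀ n, MvPowerSeries.coeff n b = if n 1 = 0 then MvPowerSeries.coeff n f else 0 :=
      fun n => rfl
    have h1 : (MvPowerSeries.X 0 : Series) ^ 2 ∣ b := by
      rw [MvPowerSeries.X_pow_dvd_iff]
      intro n hn
      rw [hb]
      split_ifs with h0
      · have : n = Finsupp.single 0 (n 0) := by
          ext s; fin_cases s <;> simp [h0]
        rw [this]
        interval_cases n 0
        · simpa using hc.1
        · simpa [coeffX] using hc.2
      · rfl
    have h2 : (MvPowerSeries.X 1 : Series) ∣ f - b := by
      rw [MvPowerSeries.X_dvd_iff]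
      intro n hn
      rw [map_sub, hb, if_pos hn, sub_self]
    obtain ⟨p, hp⟩ := h1
    obtain ⟨q, hq⟩ := h2
    refine Ideal.mem_span_pair.2 ⟨p, q, ?_⟩
    linear_combination -hp - hq

lemma finrank_quotient_span_X_sq : Module.finrank ℂ
    (Series ⧸ Ideal.span {(MvPowerSeries.X 0 : Series) ^ 2, MvPowerSeries.X 1}) = 2 := by
  set I := Ideal.span {(MvPowerSeries.X 0 : Series) ^ 2, MvPowerSeries.X 1} with hI
  let T : Series →ₗ[ℂ] ℂ × ℂ := (MvPowerSeries.coeff 0).prod (MvPowerSeries.coeff (Finsupp.single 0 1))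
  have hker : LinearMap.ker T = I.restrictScalars ℂ := by
    ext f
    rw [Submodule.restrictScalars_mem, mem_span_X_sq_iff, LinearMap.mem_ker, Prod.ext_iff]
    rfl
  have hs : Function.Surjective T := by
    rintro ⟨a, b⟩
    refine ⟨algebraMap ℂ _ a + b • MvPowerSeries.X 0, ?_⟩
    ext <;> simp [T, MvPowerSeries.algebraMap_apply, MvPowerSeries.coeff_C]
  rw [← (Submodule.Quotient.restrictScalarsEquiv ℂ I).finrank_eq, ← hker,
    (T.quotKerEquivOfSurjective hs).finrank_eq]
  simp

/-- The difference of the two generators is `x²` times the unit `q - p`, so they generate `(x², y)`,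
whose quotient has basis `1, x`. -/
lemma intersectionNumber_eq_two {p q : Series}
    (h : MvPowerSeries.constantCoeff p ≠ MvPowerSeries.constantCoeff q) :
    intersectionNumber (MvPowerSeries.X 1 - MvPowerSeries.X 0 ^ 2 * p)
      (MvPowerSeries.X 1 - MvPowerSeries.X 0 ^ 2 * q) = 2 := by
  have hu : IsUnit (q - p) := by
    rw [MvPowerSeries.isUnit_iff_constantCoeff, map_sub, isUnit_iff_ne_zero]
    exact sub_ne_zero.2 h.symm
  obtain ⟨u, hu⟩ := hu.exists_right_inv
  have : Ideal.span {(MvPowerSeries.X 1 - MvPowerSeries.X 0 ^ 2 * p : Series),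
      MvPowerSeries.X 1 - MvPowerSeries.X 0 ^ 2 * q} =
      Ideal.span {(MvPowerSeries.X 0 : Series) ^ 2, MvPowerSeries.X 1} := by
    apply le_antisymm
    · rw [Ideal.span_le]
      rintro _ (rfl | rfl)
      · exact Ideal.mem_span_pair.2 ⟨-p, 1, by ring⟩
      · exact Ideal.mem_span_pair.2 ⟨-q, 1, by ring⟩
    · rw [Ideal.span_le]
      rintro _ (rfl | rfl)
      · exact Ideal.mem_span_pair.2 ⟨u, -u, by linear_combination MvPowerSeries.X 0 ^ 2 * hu⟩
      · exact Ideal.mem_span_pair.2 ⟨1 + p * u, - p * u, by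
          linear_combination p * MvPowerSeries.X 0 ^ 2 * hu⟩
  rw [intersectionNumber, this, finrank_quotient_span_X_sq]

/-- With `m` distinct roots and degree at most `m`, the multiset of roots has no room for
repetitions. -/
lemma Polynomial.simple_roots_of_encard {p : Polynomial ℂ} {m : ℕ} (hdeg : p.natDegree ≤ m)
    (h : {z : ℂ | p.eval z = 0}.encard = m) :
    p ≠ 0 ∧ p.natDegree = m ∧ ∀ z, p.eval z = 0 → p.derivative.eval z ≠ 0 := by
  have hp : p ≠ 0 := by
    rintro rfl
    simp at h
  have hset : {z : ℂ | p.eval z = 0} = (p.roots.toFinset : Set ℂ) := by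
    ext z
    simp [hp]
  rw [hset, Set.encard_coe_eq_coe_finsetCard, Nat.cast_inj] at h
  have h1 : p.roots.toFinset.card ≤ p.roots.card := Multiset.toFinset_card_le _
  have h2 := p.card_roots'
  refine ⟨hp, by omega, fun z hz hz' => ?_⟩
  have hnd : p.roots.Nodup := by
    rw [← Multiset.toFinset_card_eq_card_iff_nodup]
    omega
  have := (Polynomial.one_lt_rootMultiplicity_iff_isRoot hp).2 ⟨hz, hz'⟩
  rw [← Polynomial.count_roots] at this
  have := Multiset.nodup_iff_count_le_one.1 hnd z
  omega

/-- The embedding of `ℂ⟦x⟧` into `ℂ⟦x, y⟧`. -/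
def embX : PowerSeries ℂ →ₐ[ℂ] Series :=
  PowerSeries.substAlgHom (PowerSeries.HasSubst.X (S := ℂ) (0 : Fin 2))

lemma embX_X : embX PowerSeries.X = MvPowerSeries.X 0 := by
  rw [embX, PowerSeries.substAlgHom_X]

lemma constantCoeff_embX (ζ : PowerSeries ℂ) :
    MvPowerSeries.constantCoeff (embX ζ) = PowerSeries.constantCoeff ζ := by
  have h : (PowerSeries.X : PowerSeries ℂ) ∣ ζ - algebraMap ℂ _ (PowerSeries.constantCoeff ζ) := by
    rw [PowerSeries.X_dvd_iff]; simp
  obtain ⟨w, hw⟩ := h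
  rw [sub_eq_iff_eq_add] at hw
  conv_lhs => rw [hw]
  rw [map_add, map_mul, embX_X, AlgHom.commutes]
  simp [MvPowerSeries.algebraMap_apply]

/-- The embedding of `ℂ⟦x⟧[y]` into `ℂ⟦x, y⟧`. -/
def embXY : Polynomial (PowerSeries ℂ) →+* Series :=
  Polynomial.eval₂RingHom embX.toRingHom (MvPowerSeries.X 1)

/-- A polynomial in `x`, `y` as an element of `ℂ⟦x⟧[y]`. -/
def toPolynomialY : MvPolynomial (Fin 2) ℂ →ₐ[ℂ] Polynomial (PowerSeries ℂ) :=
  MvPolynomial.aeval ![Polynomial.C PowerSeries.X, Polynomial.X]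

lemma embXY_toPolynomialY (f : MvPolynomial (Fin 2) ℂ) : embXY (toPolynomialY f) = f := by
  induction f using MvPolynomial.induction_on with
  | C a =>
    rw [toPolynomialY, MvPolynomial.aeval_C, Polynomial.algebraMap_apply, embXY,
      Polynomial.coe_eval₂RingHom, Polynomial.eval₂_C, AlgHom.toRingHom_eq_coe, RingHom.coe_coe,
      AlgHom.commutes]
    simp [MvPowerSeries.algebraMap_apply]
  | add p q hp hq => rw [map_add, map_add, hp, hq, MvPolynomial.coe_add]
  | mul_X p i hp =>
    rw [map_mul, map_mul, hp, MvPolynomial.coe_mul, MvPolynomial.coe_X]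
    congr 1
    rw [toPolynomialY, MvPolynomial.aeval_X]
    fin_cases i <;> simp [embXY, embX_X]

lemma eval_toPolynomialY (f : MvPolynomial (Fin 2) ℂ) (ζ : PowerSeries ℂ) :
    (toPolynomialY f).eval ζ = ∑ n ∈ f.support,
      PowerSeries.C (MvPolynomial.coeff n f) * (PowerSeries.X ^ n 0 * ζ ^ n 1) := by
  rw [toPolynomialY, MvPolynomial.aeval_def, MvPolynomial.eval₂_eq', Polynomial.eval_finsetSum]
  refine Finset.sum_congr rfl fun n _ => ?_
  simp [Polynomial.algebraMap_apply]

lemma alongParabola_coe (z : ℂ) (f : MvPolynomial (Fin 2) ℂ) :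
    alongParabola z f = (toPolynomialY f).eval (PowerSeries.X ^ 2 * PowerSeries.C z) := by
  rw [alongParabola, MvPowerSeries.substAlgHom_coe, eval_toPolynomialY, MvPolynomial.aeval_def,
    MvPolynomial.eval₂_eq']
  refine Finset.sum_congr rfl fun n _ => ?_
  simp only [Fin.prod_univ_two, Matrix.cons_val_zero, Matrix.cons_val_one, mul_comm (PowerSeries.C z)]
  rfl

lemma seriesCoeff_coe (f : MvPolynomial (Fin 2) ℂ) (μ ν : ℕ) : seriesCoeff f μ ν =
    MvPolynomial.coeff (Finsupp.single 0 μ + Finsupp.single 1 ν) f := by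
  rw [seriesCoeff, MvPolynomial.coeff_coe]

/-- The low-order coefficients are read off along the parabolas, where the series becomes `t²(z -
p)`; comparing `z = 1` with `z = 0` isolates the coefficient of `y`. -/
lemma isSmoothBranch_and_tangentLine (p : Series) :
    IsSmoothBranch (MvPowerSeries.X 1 - MvPowerSeries.X 0 ^ 2 * p) ∧
      tangentLine (MvPowerSeries.X 1 - MvPowerSeries.X 0 ^ 2 * p) = xAxis := by
  set g : Series := MvPowerSeries.X 1 - MvPowerSeries.X 0 ^ 2 * p with hg
  have hψ : ∀ z, alongParabola z g = PowerSeries.X ^ 2 * (PowerSeries.C z - alongParabola z p) := by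
    intro z
    rw [hg, map_sub, map_mul, map_pow, alongParabola_X0, alongParabola_X1]
    ring
  have hX : coeffX g = 0 := by
    rw [← coeff_one_alongParabola 0, hψ, PowerSeries.coeff_X_pow_mul', if_neg (by norm_num)]
  have h0 : MvPowerSeries.constantCoeff g = 0 := by
    rw [← coeff_zero_alongParabola 0, hψ, PowerSeries.coeff_X_pow_mul', if_neg (by norm_num)]
  have h2 : ∀ z, seriesCoeff g 2 0 + coeffY g * z = z - MvPowerSeries.constantCoeff p := by
    intro z
    rw [← coeff_two_alongParabola, hψ, PowerSeries.coeff_X_pow_mul', if_pos le_rfl, Nat.sub_self,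
      map_sub, coeff_zero_alongParabola]
    simp
  have hY : coeffY g = 1 := by linear_combination h2 1 - h2 0
  have hY' : coeffY g ≠ 0 := by rw [hY]; exact one_ne_zero
  exact ⟨⟨h0, Or.inr hY'⟩, tangentLine_eq_xAxis hX hY'⟩

theorem isTmGerm_of_tmConditions {m : ℕ} (f : MvPolynomial (Fin 2) ℂ)
    (hf : TmConditions m (seriesCoeff f)) : IsTmGerm m f xAxis := by
  have hsupp : ∀ n ∈ f.support, 2 * m ≤ n 0 + 2 * n 1 := by
    intro n hn
    by_contra hlt
    have := hf.1 (n 0) (n 1) (by omega)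
    rw [seriesCoeff_coe, show Finsupp.single 0 (n 0) + Finsupp.single 1 (n 1) = n by
      ext s; fin_cases s <;> simp] at this
    exact MvPolynomial.mem_support_iff.1 hn this
  -- `h(ζ)` is `f(x, x²ζ) / x^(2m)`; by `hsupp` the subtraction in the exponent is never truncated.
  -- Its reduction `p` at `x = 0` is the polynomial of condition (ii).
  set h : Polynomial (PowerSeries ℂ) := ∑ n ∈ f.support, Polynomial.monomial (n 1)
    (PowerSeries.C (MvPolynomial.coeff n f) * PowerSeries.X ^ (n 0 + 2 * n 1 - 2 * m)) with hh
  have hev : ∀ ζ, (toPolynomialY f).eval (PowerSeries.X ^ 2 * ζ) =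
      PowerSeries.X ^ (2 * m) * h.eval ζ := by
    intro ζ
    rw [eval_toPolynomialY, hh, Polynomial.eval_finsetSum, Finset.mul_sum]
    refine Finset.sum_congr rfl fun n hn => ?_
    obtain ⟨k, hk⟩ := Nat.exists_eq_add_of_le (hsupp n hn)
    rw [Polynomial.eval_monomial, hk, Nat.add_sub_cancel_left, mul_pow, ← pow_mul]
    rw [mul_assoc (PowerSeries.C _), mul_left_comm (PowerSeries.X ^ (2 * m)),
      ← mul_assoc (PowerSeries.X ^ (2 * m)), ← pow_add, ← hk, pow_add, mul_assoc]
  set p := h.map (PowerSeries.constantCoeff (R := ℂ)) with hp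
  have hpQ : ∀ z, p.eval z = PowerSeries.coeff (2 * m) (alongParabola z f) := by
    intro z
    rw [alongParabola_coe, hev, PowerSeries.coeff_X_pow_mul', if_pos le_rfl, Nat.sub_self,
      PowerSeries.coeff_zero_eq_constantCoeff_apply, PowerSeries.constantCoeff_polynomial_eval,
      PowerSeries.constantCoeff_C]
  have hdeg : p.natDegree ≤ m := by
    rw [hp, hh, Polynomial.map_sum]
    refine Polynomial.natDegree_sum_le_of_forall_le _ _ fun n hn => ?_
    rw [Polynomial.map_monomial]
    by_cases h0 : n 0 + 2 * n 1 - 2 * m = 0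
    · exact (Polynomial.natDegree_monomial_le _).trans (by omega)
    · simp [h0]
  have hcard := ((tmConditions_seriesCoeff_iff m f).1 hf).2
  simp only [← hpQ] at hcard
  obtain ⟨hp0, -, hder⟩ := Polynomial.simple_roots_of_encard hdeg hcard
  have hfin : {z : ℂ | p.eval z = 0}.Finite := Set.finite_of_encard_eq_coe hcard
  obtain ⟨c, hc⟩ : ∃ c : Fin m → ℂ, Function.Injective c ∧ ∀ i, p.eval (c i) = 0 := by
    have : Nat.card {z : ℂ | p.eval z = 0} = m := by
      rw [Nat.card_coe_set_eq, Set.ncard, hcard]; rfl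
    have := hfin.to_subtype
    let e := (Finite.equivFinOfCardEq ‹Nat.card {z : ℂ | p.eval z = 0} = m›).symm
    exact ⟨fun i => e i, fun i j hij => e.injective (Subtype.ext hij), fun i => (e i).2⟩
  choose ζ hζc hζ using fun i =>
    PowerSeries.exists_eval_eq_zero h (c i) (hc.2 i) (hder _ (hc.2 i))
  have hφ : Function.Injective fun i => PowerSeries.X ^ 2 * ζ i := by
    intro i j hij
    have := mul_left_cancel₀ (pow_ne_zero 2 PowerSeries.X_ne_zero) hij
    exact hc.1 (by rw [← hζc i, ← hζc j, this])
  have hf0 : toPolynomialY f ≠ 0 := by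
    -- If `f` were zero, every `z` would be a root of `p`, but `p` has only finitely many.
    intro h0
    obtain ⟨z, hz⟩ := hfin.infinite_compl.nonempty
    apply hz
    rw [Set.mem_ofPred_eq, hpQ, alongParabola_coe, h0]
    simp
  obtain ⟨U, hU⟩ : (∏ i, (Polynomial.X - Polynomial.C (PowerSeries.X ^ 2 * ζ i))) ∣
      toPolynomialY f := by
    have := (Multiset.prod_X_sub_C_dvd_iff_le_roots hf0
      (Finset.univ.val.map fun i => PowerSeries.X ^ 2 * ζ i)).2 (by
        rw [Multiset.le_iff_subset (Finset.univ.nodup.map hφ)]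
        intro a ha
        obtain ⟨i, -, rfl⟩ := Multiset.mem_map.1 ha
        rw [Polynomial.mem_roots hf0, Polynomial.IsRoot, hev, hζ, mul_zero])
    rw [Multiset.map_map] at this
    exact this
  have hfac : (f : Series) = embXY U *
      ∏ i, (MvPowerSeries.X 1 - MvPowerSeries.X 0 ^ 2 * embX (ζ i)) := by
    rw [← embXY_toPolynomialY, hU, map_mul, map_prod, mul_comm]
    congr 1
    refine Finset.prod_congr rfl fun i _ => ?_
    rw [embXY, Polynomial.coe_eval₂RingHom, Polynomial.eval₂_sub, Polynomial.eval₂_X,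
      Polynomial.eval₂_C, map_mul, map_pow, AlgHom.toRingHom_eq_coe, RingHom.coe_coe, embX_X]
  have hunit : IsUnit (embXY U) := by
    rw [MvPowerSeries.isUnit_iff_constantCoeff, isUnit_iff_ne_zero]
    -- Along a parabola whose `z` is not a root of `p`, the coefficient of `t^(2m)` is nonzero; it
    -- has the constant term of the cofactor as a factor.
    intro h0
    obtain ⟨z, hz⟩ := hfin.infinite_compl.nonempty
    apply hz
    have e : alongParabola z f = PowerSeries.X ^ (2 * m) * (alongParabola z (embXY U) *
        ∏ i, (PowerSeries.C z - alongParabola z (embX (ζ i)))) := by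
      have e1 : ∀ i, alongParabola z (MvPowerSeries.X 1 - MvPowerSeries.X 0 ^ 2 * embX (ζ i)) =
          PowerSeries.X ^ 2 * (PowerSeries.C z - alongParabola z (embX (ζ i))) := by
        intro i
        rw [map_sub, map_mul, map_pow, alongParabola_X0, alongParabola_X1]
        ring
      rw [hfac, map_mul, map_prod, Finset.prod_congr rfl fun i _ => e1 i, Finset.prod_mul_distrib]
      simp only [Finset.prod_const, Finset.card_univ, Fintype.card_fin]
      ring
    rw [Set.mem_ofPred_eq, hpQ, e, PowerSeries.coeff_X_pow_mul', if_pos le_rfl, Nat.sub_self,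
      PowerSeries.coeff_zero_eq_constantCoeff_apply, map_mul,
      ← PowerSeries.coeff_zero_eq_constantCoeff_apply, coeff_zero_alongParabola, h0, zero_mul]
  refine ⟨hunit.unit, _, hfac, fun i => (isSmoothBranch_and_tangentLine _).1, fun i j hij => ?_,
    fun i => (isSmoothBranch_and_tangentLine _).2⟩
  refine intersectionNumber_eq_two ?_
  rw [constantCoeff_embX, constantCoeff_embX, hζc, hζc]
  exact fun h => hij (hc.1 h)

/-! ### Ternary forms in the coordinates of a basis -/

/-- The exponent of `X₀ ^ k * X₁ ^ i * X₂ ^ j`. -/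
def ternaryExponent (k i j : ℕ) : Fin 3 →₀ ℕ :=
  Finsupp.single 0 k + Finsupp.single 1 i + Finsupp.single 2 j

@[simp] lemma ternaryExponent_zero (k i j : ℕ) : ternaryExponent k i j 0 = k := by
  simp [ternaryExponent]

@[simp] lemma ternaryExponent_one (k i j : ℕ) : ternaryExponent k i j 1 = i := by
  simp [ternaryExponent]

@[simp] lemma ternaryExponent_two (k i j : ℕ) : ternaryExponent k i j 2 = j := by
  simp [ternaryExponent]

/-- The exponents `(μ, ν)` of the affine monomials of degree at most `d`. -/
def affineExponents (d : ℕ) : Finset (ℕ × ℕ) :=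
  (Finset.range (d + 1) ×ˢ Finset.range (d + 1)).filter fun p => p.1 + p.2 ≤ d

lemma mem_affineExponents {d : ℕ} {p : ℕ × ℕ} : p ∈ affineExponents d ↔ p.1 + p.2 ≤ d := by
  simp only [affineExponents, Finset.mem_filter, Finset.mem_product, Finset.mem_range]
  omega

lemma MvPolynomial.IsHomogeneous.eq_sum_affineExponents {G : MvPolynomial (Fin 3) ℂ} {d : ℕ}
    (hG : G.IsHomogeneous d) : G = ∑ p ∈ affineExponents d,
      MvPolynomial.monomial (ternaryExponent (d - p.1 - p.2) p.1 p.2)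
        (MvPolynomial.coeff (ternaryExponent (d - p.1 - p.2) p.1 p.2) G) := by
  ext n
  rw [MvPolynomial.coeff_sum]
  simp only [MvPolynomial.coeff_monomial]
  by_cases hn : n 0 + n 1 + n 2 = d
  · have hne : ternaryExponent (d - n 1 - n 2) (n 1) (n 2) = n := by
      ext s
      fin_cases s <;> simp
      omega
    rw [Finset.sum_eq_single (n 1, n 2)]
    · rw [if_pos hne, hne]
    · intro p _ hp
      refine if_neg fun h => hp ?_
      rw [← h]
      simp
    · intro h
      exact absurd (mem_affineExponents.2 (by simp only; omega)) h
  · rw [hG.coeff_eq_zero, Finset.sum_eq_zero]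
    · intro p hp
      rw [mem_affineExponents] at hp
      refine if_neg fun h => hn ?_
      rw [← h]
      simp
      omega
    · rwa [Finsupp.degree_eq_sum, Fin.sum_univ_three]

lemma MvPolynomial.IsHomogeneous.aeval_eq_sum {G : MvPolynomial (Fin 3) ℂ} {d : ℕ}
    (hG : G.IsHomogeneous d) {R : Type*} [CommRing R] [Algebra ℂ R] (r : Fin 3 → R) :
    MvPolynomial.aeval r G = ∑ p ∈ affineExponents d,
      algebraMap ℂ R (MvPolynomial.coeff (ternaryExponent (d - p.1 - p.2) p.1 p.2) G) *
        (r 0 ^ (d - p.1 - p.2) * r 1 ^ p.1 * r 2 ^ p.2) := by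
  conv_lhs => rw [hG.eq_sum_affineExponents]
  rw [map_sum]
  refine Finset.sum_congr rfl fun p _ => ?_
  rw [MvPolynomial.aeval_monomial, Finsupp.prod_fintype _ _ (by simp), Fin.prod_univ_three]
  simp

/-- The form `F` in the coordinates of the basis `e`. -/
def toCoords (e : Module.Basis (Fin 3) ℂ (Fin 3 → ℂ)) :
    MvPolynomial (Fin 3) ℂ →ₐ[ℂ] MvPolynomial (Fin 3) ℂ :=
  MvPolynomial.aeval fun i => ∑ j, MvPolynomial.C (e j i) * MvPolynomial.X j

lemma aeval_toCoords (e : Module.Basis (Fin 3) ℂ (Fin 3 → ℂ)) (F : MvPolynomial (Fin 3) ℂ)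
    {R : Type*} [CommRing R] [Algebra ℂ R] (r : Fin 3 → R) :
    MvPolynomial.aeval r (toCoords e F) =
      MvPolynomial.aeval (fun i => ∑ j, algebraMap ℂ R (e j i) * r j) F := by
  rw [toCoords, ← AlgHom.comp_apply, MvPolynomial.comp_aeval]
  simp

lemma MvPolynomial.IsHomogeneous.toCoords {F : MvPolynomial (Fin 3) ℂ} {d : ℕ}
    (hF : F.IsHomogeneous d) (e : Module.Basis (Fin 3) ℂ (Fin 3 → ℂ)) :
    (toCoords e F).IsHomogeneous d := by
  have := hF.aeval (fun i => ∑ j, MvPolynomial.C (e j i) * MvPolynomial.X j) (n := 1) fun i =>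
    MvPolynomial.IsHomogeneous.sum _ _ _ fun j _ => MvPolynomial.isHomogeneous_C_mul_X _ _
  rwa [one_mul] at this

lemma affineEquation_eq (e : Module.Basis (Fin 3) ℂ (Fin 3 → ℂ)) (F : MvPolynomial (Fin 3) ℂ) :
    affineEquation e F =
      MvPolynomial.aeval ![1, MvPolynomial.X 0, MvPolynomial.X 1] (toCoords e F) := by
  rw [aeval_toCoords, affineEquation]
  congr 2
  ext1 i
  simp [Fin.sum_univ_three, MvPolynomial.algebraMap_eq]

lemma affineCoeff_eq {d : ℕ} (e : Module.Basis (Fin 3) ℂ (Fin 3 → ℂ))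
    {F : MvPolynomial (Fin 3) ℂ} (hF : F.IsHomogeneous d) (μ ν : ℕ) :
    affineCoeff e F μ ν = if μ + ν ≤ d then
      MvPolynomial.coeff (ternaryExponent (d - μ - ν) μ ν) (toCoords e F) else 0 := by
  rw [affineCoeff, affineEquation_eq, (hF.toCoords e).aeval_eq_sum, MvPolynomial.coeff_sum]
  have : ∀ p : ℕ × ℕ, MvPolynomial.coeff (Finsupp.single 0 μ + Finsupp.single 1 ν)
      (algebraMap ℂ (MvPolynomial (Fin 2) ℂ)
        (MvPolynomial.coeff (ternaryExponent (d - p.1 - p.2) p.1 p.2) (toCoords e F)) *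
        ((![1, MvPolynomial.X 0, MvPolynomial.X 1] : Fin 3 → MvPolynomial (Fin 2) ℂ) 0
            ^ (d - p.1 - p.2) *
          (![1, MvPolynomial.X 0, MvPolynomial.X 1] : Fin 3 → MvPolynomial (Fin 2) ℂ) 1 ^ p.1 *
          (![1, MvPolynomial.X 0, MvPolynomial.X 1] : Fin 3 → MvPolynomial (Fin 2) ℂ) 2 ^ p.2)) =
      if p = (μ, ν) then
        MvPolynomial.coeff (ternaryExponent (d - μ - ν) μ ν) (toCoords e F) else 0 := by
    intro p
    have hm : (MvPolynomial.X 0 ^ p.1 * MvPolynomial.X 1 ^ p.2 : MvPolynomial (Fin 2) ℂ) =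
        MvPolynomial.monomial (Finsupp.single 0 p.1 + Finsupp.single 1 p.2) 1 := by
      rw [MvPolynomial.X_pow_eq_monomial, MvPolynomial.X_pow_eq_monomial,
        MvPolynomial.monomial_mul, one_mul]
    simp only [Matrix.cons_val_zero, Matrix.cons_val_one, one_pow, one_mul,
      MvPolynomial.algebraMap_eq, Matrix.cons_val]
    rw [hm, MvPolynomial.coeff_C_mul, MvPolynomial.coeff_monomial]
    by_cases hp : p = (μ, ν)
    · subst hp; simp
    · rw [if_neg hp, if_neg, mul_zero]
      intro h
      apply hp
      have h0 := DFunLike.congr_fun h 0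
      have h1 := DFunLike.congr_fun h 1
      simp at h0 h1
      exact Prod.ext h0 h1
  rw [Finset.sum_congr rfl fun p _ => this p, Finset.sum_ite_eq']
  simp [mem_affineExponents]

lemma aeval_toCoords_eq_sum {d : ℕ} (e : Module.Basis (Fin 3) ℂ (Fin 3 → ℂ))
    {F : MvPolynomial (Fin 3) ℂ} (hF : F.IsHomogeneous d)
    {R : Type*} [CommRing R] [Algebra ℂ R] (r : Fin 3 → R) :
    MvPolynomial.aeval r (toCoords e F) = ∑ p ∈ affineExponents d,
      algebraMap ℂ R (affineCoeff e F p.1 p.2) *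
        (r 0 ^ (d - p.1 - p.2) * r 1 ^ p.1 * r 2 ^ p.2) := by
  rw [(hF.toCoords e).aeval_eq_sum]
  refine Finset.sum_congr rfl fun p hp => ?_
  rw [affineCoeff_eq e hF, if_pos (mem_affineExponents.1 hp)]

lemma alongParabola_affineEquation (e : Module.Basis (Fin 3) ℂ (Fin 3 → ℂ))
    (F : MvPolynomial (Fin 3) ℂ) (z : ℂ) :
    alongParabola z (affineEquation e F : MvPowerSeries (Fin 2) ℂ) =
      MvPolynomial.aeval ![1, PowerSeries.X, PowerSeries.C z * PowerSeries.X ^ 2]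
        (toCoords e F) := by
  rw [affineEquation_eq, alongParabola, MvPowerSeries.substAlgHom_coe]
  have h := fun (r : Fin 3 → MvPolynomial (Fin 2) ℂ) (s : Fin 2 → PowerSeries ℂ) =>
    DFunLike.congr_fun (MvPolynomial.comp_aeval r (MvPolynomial.aeval (R := ℂ) s)) (toCoords e F)
  refine (h _ ![PowerSeries.X, PowerSeries.C z * PowerSeries.X ^ 2]).trans ?_
  congr 2
  ext1 i
  fin_cases i <;> simp

/-! ### Independence of the adapted frame -/

/-- Both bases respect the flag formed by `A`, `Λ` and the whole space, so the change of basis is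
triangular with nonzero diagonal. -/
lemma IsAdapted.exists_eq {A : Projectivization ℂ (Fin 3 → ℂ)} {Λ : Submodule ℂ (Fin 3 → ℂ)}
    {e e' : Module.Basis (Fin 3) ℂ (Fin 3 → ℂ)} (h : IsAdapted e A Λ) (h' : IsAdapted e' A Λ) :
    ∃ a b c p q r : ℂ, a ≠ 0 ∧ b ≠ 0 ∧ c ≠ 0 ∧ e 0 = a • e' 0 ∧ e 1 = p • e' 0 + b • e' 1 ∧
      e 2 = q • e' 0 + r • e' 1 + c • e' 2 := by
  have h0 : e 0 ∈ Submodule.span ℂ {e' 0} := by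
    rw [← h'.1, h.1]; exact Submodule.mem_span_singleton_self _
  obtain ⟨a, ha⟩ := Submodule.mem_span_singleton.1 h0
  have h1 : e 1 ∈ Submodule.span ℂ {e' 0, e' 1} := by
    rw [← h'.2, h.2]; exact Submodule.subset_span (by simp)
  obtain ⟨p, b, hpb⟩ := Submodule.mem_span_pair.1 h1
  have h2 := (e'.sum_repr (e 2)).symm
  rw [Fin.sum_univ_three] at h2
  have ha0 : a ≠ 0 := by
    rintro rfl
    exact e.ne_zero 0 (by rw [← ha, zero_smul])
  have hli := e.linearIndependent
  refine ⟨a, b, _, p, _, _, ha0, ?_, ?_, ha.symm, hpb.symm, h2⟩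
  · rintro rfl
    have h3 : e 1 = (p * a⁻¹) • e 0 := by
      rw [← hpb, ← ha, smul_smul, mul_assoc, inv_mul_cancel₀ ha0]; simp
    have := congrArg (fun v => e.repr v 1) h3
    simp at this
  · intro hc
    have h3 : e 2 ∈ Submodule.span ℂ {e 0, e 1} := by
      rw [← h.2, h'.2, h2, hc, zero_smul, add_zero]
      exact Submodule.mem_span_pair.2 ⟨_, _, rfl⟩
    obtain ⟨s, t, hst⟩ := Submodule.mem_span_pair.1 h3
    have := congrArg (fun v => e.repr v 2) hst
    simp at this

/-- In the frame `e'`, the parabola of `e` has coordinates `a + pt + qzt²`, `t(b + rzt)` and `t²cz`.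
A term of weight `w` therefore still carries `t^w`, and in weight `2m` the polynomial of condition
(ii) only changes by a nonzero factor and the rescaling of `z` by `ac/b²`. -/
theorem TmConditions.of_isAdapted {A : Projectivization ℂ (Fin 3 → ℂ)}
    {Λ : Submodule ℂ (Fin 3 → ℂ)} {e e' : Module.Basis (Fin 3) ℂ (Fin 3 → ℂ)}
    (h : IsAdapted e A Λ) (h' : IsAdapted e' A Λ) {m d : ℕ} (hd : 2 * m ≤ d)
    {F : MvPolynomial (Fin 3) ℂ} (hF : F.IsHomogeneous d)
    (hm : TmConditions m (affineCoeff e' F)) : TmConditions m (affineCoeff e F) := by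
  obtain ⟨a, b, c, p, q, r, ha, hb, hc, h0, h1, h2⟩ := IsAdapted.exists_eq h h'
  set X : PowerSeries ℂ := PowerSeries.X with hX
  have key : ∀ z, alongParabola z (affineEquation e F : MvPowerSeries (Fin 2) ℂ) =
      ∑ n ∈ affineExponents d, X ^ (n.1 + 2 * n.2) * (PowerSeries.C (affineCoeff e' F n.1 n.2) *
        ((PowerSeries.C a + PowerSeries.C p * X + PowerSeries.C (q * z) * X ^ 2) ^ (d - n.1 - n.2) *
        (PowerSeries.C b + PowerSeries.C (r * z) * X) ^ n.1 * PowerSeries.C (c * z) ^ n.2)) := by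
    intro z
    rw [alongParabola_affineEquation, aeval_toCoords]
    have e1 : (fun i => ∑ j, algebraMap ℂ (PowerSeries ℂ) (e j i) *
          (![1, X, PowerSeries.C z * X ^ 2] : Fin 3 → PowerSeries ℂ) j) =
        fun i => ∑ j, algebraMap ℂ (PowerSeries ℂ) (e' j i) *
          (![PowerSeries.C a + PowerSeries.C p * X + PowerSeries.C (q * z) * X ^ 2,
            X * (PowerSeries.C b + PowerSeries.C (r * z) * X),
            X ^ 2 * PowerSeries.C (c * z)] : Fin 3 → PowerSeries ℂ) j := by
      ext1 i
      simp only [Fin.sum_univ_three, h0, h1, h2, PowerSeries.algebraMap_apply,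
        Algebra.algebraMap_self, RingHom.id_apply, Pi.add_apply, Pi.smul_apply, smul_eq_mul,
        map_add, map_mul, Matrix.cons_val_zero, Matrix.cons_val_one, Matrix.cons_val]
      ring
    rw [e1, ← aeval_toCoords, aeval_toCoords_eq_sum e' hF]
    refine Finset.sum_congr rfl fun n _ => ?_
    simp only [PowerSeries.algebraMap_apply, Algebra.algebraMap_self, RingHom.id_apply,
      Matrix.cons_val_zero, Matrix.cons_val_one, Matrix.cons_val]
    rw [mul_pow X, mul_pow (X ^ 2), pow_add, pow_mul X 2]
    ring
  have hcoe : affineCoeff e F = seriesCoeff (affineEquation e F : MvPowerSeries (Fin 2) ℂ) := by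
    ext μ ν
    rw [seriesCoeff_coe, affineCoeff]
  rw [hcoe, tmConditions_seriesCoeff_iff]
  constructor
  · intro z k hk
    rw [key, map_sum]
    refine Finset.sum_eq_zero fun n _ => ?_
    rw [PowerSeries.coeff_X_pow_mul']
    split_ifs with hn
    · rw [hm.1 _ _ (by omega)]; simp
    · rfl
  · have hQ : ∀ z, PowerSeries.coeff (2 * m)
        (alongParabola z (affineEquation e F : MvPowerSeries (Fin 2) ℂ)) =
        a ^ (d - 2 * m) * b ^ (2 * m) * ∑ n ∈ Finset.HasAntidiagonal.antidiagonal m,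
          affineCoeff e' F (2 * n.1) n.2 * (a * c / b ^ 2 * z) ^ n.2 := by
      intro z
      have hterm : ∀ n : ℕ × ℕ, PowerSeries.coeff (2 * m) (X ^ (n.1 + 2 * n.2) *
          (PowerSeries.C (affineCoeff e' F n.1 n.2) *
          ((PowerSeries.C a + PowerSeries.C p * X + PowerSeries.C (q * z) * X ^ 2)
            ^ (d - n.1 - n.2) * (PowerSeries.C b + PowerSeries.C (r * z) * X) ^ n.1 *
            PowerSeries.C (c * z) ^ n.2))) =
          if n.1 + 2 * n.2 = 2 * m then affineCoeff e' F n.1 n.2 *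
            (a ^ (d - n.1 - n.2) * b ^ n.1 * (c * z) ^ n.2) else 0 := by
        intro n
        rw [PowerSeries.coeff_X_pow_mul']
        rcases lt_trichotomy (n.1 + 2 * n.2) (2 * m) with hn | hn | hn
        · rw [hm.1 _ _ hn, if_neg hn.ne]; simp
        · rw [if_pos hn.le, if_pos hn, hn, Nat.sub_self,
            PowerSeries.coeff_zero_eq_constantCoeff_apply]
          simp [hX]
        · rw [if_neg hn.not_ge, if_neg hn.ne']
      rw [key, map_sum, Finset.sum_congr rfl fun n _ => hterm n, ← Finset.sum_filter,
        Finset.mul_sum]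
      -- Weight `2m` forces `μ` to be even; since `2m ≤ d`, no pair is lost to the degree bound.
      refine Finset.sum_nbij' (fun n => (n.1 / 2, n.2)) (fun n => (2 * n.1, n.2)) ?_ ?_ ?_ ?_ ?_
      · intro n hn
        rw [Finset.mem_filter] at hn
        rw [Finset.HasAntidiagonal.mem_antidiagonal]
        simp only
        omega
      · intro n hn
        rw [Finset.HasAntidiagonal.mem_antidiagonal] at hn
        rw [Finset.mem_filter, mem_affineExponents]
        simp only
        omega
      · intro n hn
        rw [Finset.mem_filter] at hn
        ext
        · simp only; omega
        · rfl
      · intro n _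
        ext
        · simp only; omega
        · rfl
      · rintro ⟨i, j⟩ hn
        rw [Finset.mem_filter] at hn
        simp only at hn ⊢
        obtain ⟨k, rfl⟩ : ∃ k, i = 2 * k := ⟨i / 2, by omega⟩
        have hkj : m = k + j := by omega
        rw [Nat.mul_div_cancel_left _ (by norm_num), show d - 2 * k - j = d - 2 * m + j by omega,
          hkj]
        rw [pow_add, mul_add, pow_add b, mul_pow (a * c / b ^ 2), div_pow, mul_pow a, mul_pow c,
          ← pow_mul b]
        field_simp
    have hκ : a * c / b ^ 2 ≠ 0 := div_ne_zero (mul_ne_zero ha hc) (pow_ne_zero _ hb)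
    rw [← hm.2]
    have hset : {z : ℂ | PowerSeries.coeff (2 * m)
        (alongParabola z (affineEquation e F : MvPowerSeries (Fin 2) ℂ)) = 0} =
        (Equiv.mulLeft₀ _ hκ).symm '' {z : ℂ | ∑ n ∈ Finset.HasAntidiagonal.antidiagonal m,
          affineCoeff e' F (2 * n.1) n.2 * z ^ n.2 = 0} := by
      ext z
      rw [Equiv.image_symm_eq_preimage, Set.mem_ofPred_eq, hQ, mul_eq_zero, or_iff_right]
      · rfl
      · exact mul_ne_zero (pow_ne_zero _ ha) (pow_ne_zero _ hb)
    rw [hset, (Equiv.injective _).encard_image]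

theorem hasTmSingularity_iff {A : Projectivization ℂ (Fin 3 → ℂ)}
    {Λ : Submodule ℂ (Fin 3 → ℂ)} {e : Module.Basis (Fin 3) ℂ (Fin 3 → ℂ)}
    (h : IsAdapted e A Λ) {m d : ℕ} (hd : 2 * m ≤ d)
    {F : MvPolynomial (Fin 3) ℂ} (hF : F.IsHomogeneous d) :
    HasTmSingularity m F A Λ ↔ TmConditions m (affineCoeff e F) := by
  have hcoe : ∀ e, affineCoeff e F =
      seriesCoeff (affineEquation e F : MvPowerSeries (Fin 2) ℂ) := by
    intro e
    ext μ ν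
    rw [seriesCoeff_coe, affineCoeff]
  constructor
  · rintro ⟨e', h', hT⟩
    refine TmConditions.of_isAdapted h h' hd hF ?_
    rw [hcoe]
    exact tmConditions_of_isTmGerm hT
  · intro hT
    rw [hcoe] at hT
    exact ⟨e, h, isTmGerm_of_tmConditions _ hT⟩

/-! ### Adapted bases and the inverse change of coordinates -/

lemma exists_isAdapted {A : Projectivization ℂ (Fin 3 → ℂ)} {Λ : Submodule ℂ (Fin 3 → ℂ)}
    (hΛ : Module.finrank ℂ Λ = 2) (hA : A.submodule ≤ Λ) : ∃ e, IsAdapted e A Λ := by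
  set a := A.rep
  have ha : a ≠ 0 := A.rep_nonzero
  have hAa : A.submodule = Submodule.span ℂ {a} := by
    rw [Projectivization.submodule_eq]
  have haΛ : Submodule.span ℂ {a} ≤ Λ := hAa ▸ hA
  obtain ⟨b, hb, hba⟩ : ∃ b ∈ Λ, b ∉ Submodule.span ℂ {a} := by
    by_contra! hcon
    have : Λ = Submodule.span ℂ {a} := le_antisymm hcon haΛ
    rw [this, finrank_span_singleton ha] at hΛ
    omega
  have hab : LinearIndependent ℂ ![a, b] := by
    rw [LinearIndependent.pair_iff' ha]
    intro t ht
    exact hba (Submodule.mem_span_singleton.2 ⟨t, ht⟩)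
  have hspan : Λ = Submodule.span ℂ {a, b} := by
    symm
    apply Submodule.eq_of_le_of_finrank_eq
    · rw [Submodule.span_le]
      rintro x (rfl | rfl)
      · exact haΛ (Submodule.mem_span_singleton_self _)
      · exact hb
    · have := finrank_span_eq_card hab
      rw [Matrix.range_cons_cons_empty] at this
      rw [this, hΛ]
      rfl
  obtain ⟨c, hc⟩ : ∃ c, c ∉ Λ := by
    by_contra! hcon
    have : Λ = ⊤ := (Submodule.eq_top_iff').2 hcon
    rw [this, finrank_top] at hΛ
    simp at hΛ
  have habc : LinearIndependent ℂ (Fin.snoc ![a, b] c : Fin 3 → Fin 3 → ℂ) := by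
    rw [linearIndependent_finSnoc]
    refine ⟨hab, ?_⟩
    rw [Matrix.range_cons_cons_empty, ← hspan]
    exact hc
  let e := basisOfLinearIndependentOfCardEqFinrank habc (by simp)
  have he : ∀ i, e i = (Fin.snoc ![a, b] c : Fin 3 → Fin 3 → ℂ) i := fun i => by
    simp [e]
  refine ⟨e, ?_, ?_⟩
  · rw [hAa, he]; rfl
  · rw [hspan, he, he]; rfl

/-- The form `G` in the coordinates of the basis `e`, seen as a form in the standard coordinates. -/
def ofCoords (e : Module.Basis (Fin 3) ℂ (Fin 3 → ℂ)) :
    MvPolynomial (Fin 3) ℂ →ₐ[ℂ] MvPolynomial (Fin 3) ℂ :=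
  MvPolynomial.aeval fun j => ∑ i, MvPolynomial.C (e.repr (Pi.single i 1) j) * MvPolynomial.X i

lemma toCoords_ofCoords (e : Module.Basis (Fin 3) ℂ (Fin 3 → ℂ)) (G : MvPolynomial (Fin 3) ℂ) :
    toCoords e (ofCoords e G) = G := by
  suffices (toCoords e).comp (ofCoords e) = AlgHom.id ℂ _ from DFunLike.congr_fun this G
  ext1 j
  have h : ∀ k, ∑ i, e.repr (Pi.single i 1) j * e k i = if k = j then 1 else 0 := by
    intro k
    have h1 : ∑ i, e k i • (Pi.single i 1 : Fin 3 → ℂ) = e k := by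
      ext l; simp [Finset.sum_apply, Pi.single_apply]
    have h2 := congrArg (fun v => e.repr v j) h1
    simp only [map_sum, map_smul, Module.Basis.repr_self, Finsupp.coe_finsetSum, Finset.sum_apply,
      Finsupp.smul_apply, smul_eq_mul, Finsupp.single_apply] at h2
    rw [← h2]
    exact Finset.sum_congr rfl fun i _ => mul_comm _ _
  simp only [AlgHom.comp_apply, ofCoords, toCoords, MvPolynomial.aeval_X, map_sum, map_mul,
    MvPolynomial.algHom_C, MvPolynomial.algebraMap_eq, AlgHom.id_apply, Finset.mul_sum]
  rw [Finset.sum_comm]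
  have h3 : ∀ k, ∑ i, MvPolynomial.C (e.repr (Pi.single i 1) j) *
      (MvPolynomial.C (e k i) * MvPolynomial.X k) =
      (MvPolynomial.C (if k = j then 1 else 0) * MvPolynomial.X k : MvPolynomial (Fin 3) ℂ) := by
    intro k
    rw [← h, map_sum, Finset.sum_mul]
    simp only [map_mul, mul_assoc]
  simp [h3]

lemma ofCoords_toCoords (e : Module.Basis (Fin 3) ℂ (Fin 3 → ℂ)) (F : MvPolynomial (Fin 3) ℂ) :
    ofCoords e (toCoords e F) = F := by
  suffices (ofCoords e).comp (toCoords e) = AlgHom.id ℂ _ from DFunLike.congr_fun this F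
  ext1 i
  have h : ∀ l, ∑ j, e j i * e.repr (Pi.single l 1) j = if i = l then 1 else 0 := by
    intro l
    have h2 := congrFun (e.sum_repr (Pi.single l 1)) i
    simp only [Finset.sum_apply, Pi.smul_apply, smul_eq_mul, Pi.single_apply] at h2
    rw [← h2]
    exact Finset.sum_congr rfl fun i _ => mul_comm _ _
  simp only [AlgHom.comp_apply, ofCoords, toCoords, MvPolynomial.aeval_X, map_sum, map_mul,
    MvPolynomial.algHom_C, MvPolynomial.algebraMap_eq, AlgHom.id_apply, Finset.mul_sum]
  rw [Finset.sum_comm]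
  have h3 : ∀ l, ∑ j, MvPolynomial.C (e j i) *
      (MvPolynomial.C (e.repr (Pi.single l 1) j) * MvPolynomial.X l) =
      (MvPolynomial.C (if i = l then 1 else 0) * MvPolynomial.X l : MvPolynomial (Fin 3) ℂ) := by
    intro l
    rw [← h, map_sum, Finset.sum_mul]
    simp only [map_mul, mul_assoc]
  simp [h3]

lemma MvPolynomial.IsHomogeneous.ofCoords {F : MvPolynomial (Fin 3) ℂ} {d : ℕ}
    (hF : F.IsHomogeneous d) (e : Module.Basis (Fin 3) ℂ (Fin 3 → ℂ)) :
    (ofCoords e F).IsHomogeneous d := by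
  have := hF.aeval
    (fun j => ∑ i, MvPolynomial.C (e.repr (Pi.single i 1) j) * MvPolynomial.X i) (n := 1) fun i =>
    MvPolynomial.IsHomogeneous.sum _ _ _ fun j _ => MvPolynomial.isHomogeneous_C_mul_X _ _
  rwa [one_mul] at this

lemma isUnit_toCoords_iff (e : Module.Basis (Fin 3) ℂ (Fin 3 → ℂ)) (F : MvPolynomial (Fin 3) ℂ) :
    IsUnit (toCoords e F) ↔ IsUnit F := by
  refine ⟨fun h => ?_, fun h => h.map _⟩
  rw [← ofCoords_toCoords e F]
  exact h.map _

/-! ### Singular points in adapted coordinates, and squarefreeness -/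

/-- The chain rule for the substitution of polynomials into a polynomial. -/
lemma MvPolynomial.pderiv_aeval {σ τ : Type*} [Fintype σ] (f : σ → MvPolynomial τ ℂ)
    (F : MvPolynomial σ ℂ) (j : τ) : MvPolynomial.pderiv j (MvPolynomial.aeval f F) =
      ∑ i, MvPolynomial.aeval f (MvPolynomial.pderiv i F) * MvPolynomial.pderiv j (f i) := by
  classical
  induction F using MvPolynomial.induction_on with
  | C a => simp
  | add p q hp hq => simp only [map_add, hp, hq, add_mul, Finset.sum_add_distrib]
  | mul_X p k hp =>
    have h : ∀ i, MvPolynomial.aeval f (MvPolynomial.pderiv i (p * MvPolynomial.X k)) *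
        MvPolynomial.pderiv j (f i) = MvPolynomial.aeval f (MvPolynomial.pderiv i p) *
        MvPolynomial.pderiv j (f i) * f k +
        if i = k then MvPolynomial.aeval f p * MvPolynomial.pderiv j (f k) else 0 := by
      intro i
      rw [MvPolynomial.pderiv_mul, map_add, map_mul, map_mul, MvPolynomial.aeval_X]
      split_ifs with hi
      · subst hi
        rw [MvPolynomial.pderiv_X_self, map_one]
        ring
      · rw [MvPolynomial.pderiv_X_of_ne (Ne.symm hi), map_zero]
        ring
    rw [map_mul, MvPolynomial.aeval_X, MvPolynomial.pderiv_mul, hp, Finset.sum_congr rfl fun i _ => h i,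
      Finset.sum_add_distrib, Finset.sum_mul, Finset.sum_ite_eq']
    simp only [Finset.mem_univ, if_true]

/-- The point `v` is a zero of `F` and of all its partial derivatives. -/
def IsSingularAt {n : ℕ} (F : MvPolynomial (Fin n) ℂ) (v : Fin n → ℂ) : Prop :=
  MvPolynomial.eval v F = 0 ∧ ∀ i, MvPolynomial.eval v (MvPolynomial.pderiv i F) = 0

lemma eval_toCoords (e : Module.Basis (Fin 3) ℂ (Fin 3 → ℂ)) (F : MvPolynomial (Fin 3) ℂ)
    (v : Fin 3 → ℂ) :
    MvPolynomial.eval v (toCoords e F) = MvPolynomial.eval (∑ j, v j • e j) F := by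
  have := aeval_toCoords e F v
  rw [MvPolynomial.aeval_eq_eval] at this
  refine this.trans ?_
  rw [MvPolynomial.aeval_eq_eval]
  congr 2
  ext i
  simp [Finset.sum_apply, mul_comm]

lemma isSingularAt_toCoords_iff (e : Module.Basis (Fin 3) ℂ (Fin 3 → ℂ))
    (F : MvPolynomial (Fin 3) ℂ) (v : Fin 3 → ℂ) :
    IsSingularAt (toCoords e F) v ↔ IsSingularAt F (∑ j, v j • e j) := by
  rw [IsSingularAt, IsSingularAt, eval_toCoords]
  refine and_congr_right fun _ => ?_
  have key : ∀ j, MvPolynomial.eval v (MvPolynomial.pderiv j (toCoords e F)) =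
      ∑ i, e j i * MvPolynomial.eval (∑ j, v j • e j) (MvPolynomial.pderiv i F) := by
    intro j
    rw [toCoords, MvPolynomial.pderiv_aeval, map_sum]
    refine Finset.sum_congr rfl fun i _ => ?_
    rw [map_mul, ← eval_toCoords e, mul_comm]
    congr 1
    simp [MvPolynomial.pderiv_X, Pi.single_apply]
  simp only [key]
  refine ⟨fun h => ?_, fun h j => by simp [h]⟩
  set g : Fin 3 → ℂ := fun i => MvPolynomial.eval (∑ j, v j • e j) (MvPolynomial.pderiv i F)
  -- The gradient, seen as a linear functional, vanishes on a basis and so is zero.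
  have hT : (∑ i, g i • LinearMap.proj (R := ℂ) (φ := fun _ : Fin 3 => ℂ) i) = 0 := by
    refine e.ext fun j => ?_
    rw [LinearMap.zero_apply, ← h j]
    simp [g, LinearMap.sum_apply, mul_comm]
  intro i
  have := DFunLike.congr_fun hT (Pi.single i 1)
  simpa [LinearMap.sum_apply, Pi.single_apply] using this

lemma MvPolynomial.IsHomogeneous.eval_smul {n d : ℕ} {F : MvPolynomial (Fin n) ℂ}
    (hF : F.IsHomogeneous d) (t : ℂ) (v : Fin n → ℂ) :
    MvPolynomial.eval (t • v) F = t ^ d * MvPolynomial.eval v F := by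
  rw [MvPolynomial.eval_eq', MvPolynomial.eval_eq', Finset.mul_sum]
  refine Finset.sum_congr rfl fun m hm => ?_
  simp only [Pi.smul_apply, smul_eq_mul, mul_pow, Finset.prod_mul_distrib]
  rw [Finset.prod_pow_eq_pow_sum, ← Finsupp.degree_eq_sum, hF.degree_eq_sum_deg_support hm,
    Finsupp.degree_apply]
  ring

lemma IsSingularAt.smul {n d : ℕ} {F : MvPolynomial (Fin n) ℂ}
    (hF : F.IsHomogeneous d) {v : Fin n → ℂ} (h : IsSingularAt F v) (t : ℂ) :
    IsSingularAt F (t • v) := by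
  refine ⟨by rw [hF.eval_smul, h.1, mul_zero], fun i => ?_⟩
  rw [hF.pderiv.eval_smul, h.2, mul_zero]

/-- Homogeneity makes singularity invariant under scaling, so the representatives chosen for
projective points play no role. -/
lemma singularLocus_eq_singleton_iff {A : Projectivization ℂ (Fin 3 → ℂ)}
    {Λ : Submodule ℂ (Fin 3 → ℂ)} {e : Module.Basis (Fin 3) ℂ (Fin 3 → ℂ)} (he : IsAdapted e A Λ)
    {F : MvPolynomial (Fin 3) ℂ} {d : ℕ} (hF : F.IsHomogeneous d) :
    singularLocus F = {A} ↔ IsSingularAt (toCoords e F) ![1, 0, 0] ∧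
      ∀ v, v ≠ 0 → IsSingularAt (toCoords e F) v → v 1 = 0 ∧ v 2 = 0 := by
  have hA : Submodule.span ℂ {A.rep} = Submodule.span ℂ {e 0} := by
    rw [← he.1, Projectivization.submodule_eq]
  have hv : ∀ v : Fin 3 → ℂ, (∑ j, v j • e j) ∈ Submodule.span ℂ {e 0} ↔ v 1 = 0 ∧ v 2 = 0 := by
    intro v
    rw [Submodule.mem_span_singleton]
    constructor
    · rintro ⟨t, ht⟩
      have h1 := congrArg (fun w => e.repr w 1) ht
      have h2 := congrArg (fun w => e.repr w 2) ht
      simp [Fin.sum_univ_three] at h1 h2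
      exact ⟨h1.symm, h2.symm⟩
    · rintro ⟨h1, h2⟩
      exact ⟨v 0, by simp [Fin.sum_univ_three, h1, h2]⟩
  have hrep : ∀ P : Projectivization ℂ (Fin 3 → ℂ), P = A ↔ P.rep ∈ Submodule.span ℂ {e 0} := by
    intro P
    rw [← hA]
    constructor
    · rintro rfl
      exact Submodule.mem_span_singleton_self _
    · intro h
      rw [← Projectivization.submodule_injective.eq_iff, Projectivization.submodule_eq,
        Projectivization.submodule_eq]
      obtain ⟨t, ht⟩ := Submodule.mem_span_singleton.1 h
      have ht0 : t ≠ 0 := by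
        rintro rfl
        exact P.rep_nonzero (by rw [← ht, zero_smul])
      rw [← ht]
      exact Submodule.span_singleton_smul_eq (IsUnit.mk0 t ht0) _
  have hmem : ∀ P, P ∈ singularLocus F ↔ IsSingularAt F P.rep := fun P => Iff.rfl
  have hsum : ∀ w, ∑ j, e.repr w j • e j = w := fun w => e.sum_repr w
  rw [isSingularAt_toCoords_iff, Set.eq_singleton_iff_unique_mem, hmem]
  refine and_congr ?_ ?_
  · have h0 : ∑ j, (![1, 0, 0] : Fin 3 → ℂ) j • e j = e 0 := by simp [Fin.sum_univ_three]
    rw [h0]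
    obtain ⟨t, ht⟩ := Submodule.mem_span_singleton.1 (hA ▸ Submodule.mem_span_singleton_self A.rep)
    obtain ⟨s, hs⟩ := Submodule.mem_span_singleton.1
      (hA.symm ▸ Submodule.mem_span_singleton_self (e 0))
    exact ⟨fun h => hs ▸ h.smul hF s, fun h => ht ▸ h.smul hF t⟩
  · constructor
    · intro h v hv0 hsing
      rw [isSingularAt_toCoords_iff] at hsing
      rw [← hv]
      have hw : (∑ j, v j • e j) ≠ 0 := by
        intro h0
        apply hv0
        ext j
        have := Fintype.linearIndependent_iff.1 e.linearIndependent v h0 j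
        simpa using this
      obtain ⟨a, ha⟩ := Projectivization.exists_smul_eq_mk_rep ℂ _ hw
      have h1 := h (Projectivization.mk ℂ _ hw) (by
        rw [hmem, ← ha]; exact hsing.smul hF _)
      rw [hrep, ← ha] at h1
      have := Submodule.smul_mem _ ((a⁻¹ : ℂˣ) : ℂ) h1
      rwa [Units.smul_def, smul_smul, ← Units.val_mul, inv_mul_cancel, Units.val_one,
        one_smul] at this
    · intro h P hP
      rw [hmem] at hP
      have h1 := h (e.repr P.rep) (by
        intro h0
        apply P.rep_nonzero
        rw [← hsum P.rep, h0]; simp) (by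
        rw [isSingularAt_toCoords_iff, hsum]; exact hP)
      rw [hrep, ← hsum P.rep, hv]
      exact h1

lemma MvPolynomial.isUnit_of_dvd_X_pow {D : MvPolynomial (Fin 3) ℂ} {i j : Fin 3} (hij : i ≠ j)
    {k l : ℕ} (hi : D ∣ MvPolynomial.X i ^ k) (hj : D ∣ MvPolynomial.X j ^ l) : IsUnit D := by
  obtain ⟨n, -, hn⟩ := (dvd_prime_pow (MvPolynomial.X_prime (i := i)) k).1 hi
  rcases Nat.eq_zero_or_pos n with rfl | hpos
  · rw [pow_zero] at hn
    exact hn.symm.isUnit isUnit_one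
  · exfalso
    have h1 : (MvPolynomial.X i : MvPolynomial (Fin 3) ℂ) ∣ MvPolynomial.X j ^ l :=
      ((dvd_pow_self _ hpos.ne').trans hn.symm.dvd).trans hj
    have h2 := MvPolynomial.X_prime.dvd_of_dvd_pow h1
    exact hij (MvPolynomial.X_dvd_X.1 h2)

/-- A form with a square factor `D²` is singular wherever `D` vanishes, so `X 1` and `X 2` vanish on
the zero locus of `D`. By the Nullstellensatz `D` divides a power of each of them, and is a unit. -/
lemma squarefree_of_isSingularAt {G : MvPolynomial (Fin 3) ℂ}
    (h : ∀ v, v ≠ 0 → IsSingularAt G v → v 1 = 0 ∧ v 2 = 0) : Squarefree G := by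
  rintro D ⟨E, rfl⟩
  have hz : ∀ i : Fin 3, i ≠ 0 → ∃ k, D ∣ MvPolynomial.X i ^ k := by
    intro i hi
    have : (MvPolynomial.X i : MvPolynomial (Fin 3) ℂ) ∈ (Ideal.span {D}).radical := by
      rw [← MvPolynomial.vanishingIdeal_zeroLocus_eq_radical (K := ℂ),
        MvPolynomial.mem_vanishingIdeal_iff]
      intro v hv
      have hD : MvPolynomial.eval v D = 0 := by
        have := MvPolynomial.mem_zeroLocus_iff.1 hv D (Ideal.mem_span_singleton_self D)
        rwa [MvPolynomial.aeval_eq_eval] at this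
      rw [MvPolynomial.aeval_X]
      by_cases hv0 : v = 0
      · rw [hv0]; rfl
      have h1 := h v hv0 ⟨by simp [hD], fun j => by simp [hD]⟩
      fin_cases i
      · exact absurd rfl hi
      · exact h1.1
      · exact h1.2
    obtain ⟨k, hk⟩ := this
    exact ⟨k, Ideal.mem_span_singleton.1 hk⟩
  obtain ⟨k, hk⟩ := hz 1 (by decide)
  obtain ⟨l, hl⟩ := hz 2 (by decide)
  exact MvPolynomial.isUnit_of_dvd_X_pow (by decide) hk hl

lemma squarefree_of_toCoords {e : Module.Basis (Fin 3) ℂ (Fin 3 → ℂ)} {F : MvPolynomial (Fin 3) ℂ}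
    (h : Squarefree (toCoords e F)) : Squarefree F := by
  intro D hD
  rw [← isUnit_toCoords_iff e]
  refine h _ ?_
  rw [← map_mul]
  exact map_dvd _ hD

/-! ### The weighted blowup and its strict transform -/

/-- The exponents `(μ, ν)` of the affine monomials of degree at most `6` and of weight at least `6`
for the weights `(1, 2)`. -/
def sexticExponents : Finset (ℕ × ℕ) :=
  (affineExponents 6).filter fun p => 6 ≤ p.1 + 2 * p.2

/-- The strict transform of the sextic `∑ c (μ, ν) s ^ (6 - μ - ν) x ^ μ y ^ ν` under the weighted
blowup of the point `x = y = 0` with weights `(1, 2)`, in the Cox ring `ℂ[s, x, y, t]`. -/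
def strictTransform (c : ℕ × ℕ → ℂ) : MvPolynomial (Fin 4) ℂ :=
  ∑ p ∈ sexticExponents, MvPolynomial.C (c p) * (MvPolynomial.X 0 ^ (6 - p.1 - p.2) *
    MvPolynomial.X 1 ^ p.1 * MvPolynomial.X 2 ^ p.2 * MvPolynomial.X 3 ^ (p.1 + 2 * p.2 - 6))

/-- The equations of the singular points of the strict transform. -/
def strictSystem (c : ℕ × ℕ → ℂ) : Fin 4 → MvPolynomial (Fin 4) ℂ :=
  ![strictTransform c, MvPolynomial.pderiv 0 (strictTransform c),
    MvPolynomial.pderiv 1 (strictTransform c), MvPolynomial.pderiv 2 (strictTransform c)]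

/-- The strict transform has no singular points outside the irrelevant locus. -/
def IsStrictlySmooth (c : ℕ × ℕ → ℂ) : Prop :=
  ∀ p : Fin 4 → ℂ, (∀ i, MvPolynomial.eval p (strictSystem c i) = 0) →
    (p 1 = 0 ∧ p 2 = 0) ∨ (p 0 = 0 ∧ p 3 = 0)

lemma X_pow_mul_strictTransform {G : MvPolynomial (Fin 3) ℂ} (hG : G.IsHomogeneous 6)
    {c : ℕ × ℕ → ℂ} (hc : ∀ p : ℕ × ℕ, p.1 + p.2 ≤ 6 →
      MvPolynomial.coeff (ternaryExponent (6 - p.1 - p.2) p.1 p.2) G = c p)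
    (h0 : ∀ p : ℕ × ℕ, p.1 + 2 * p.2 < 6 → c p = 0) :
    MvPolynomial.X 3 ^ 6 * strictTransform c = MvPolynomial.aeval ![MvPolynomial.X 0,
      MvPolynomial.X 3 * MvPolynomial.X 1, MvPolynomial.X 3 ^ 2 * MvPolynomial.X 2] G := by
  rw [hG.aeval_eq_sum, strictTransform, sexticExponents, Finset.sum_filter, Finset.mul_sum]
  refine Finset.sum_congr rfl fun p hp => ?_
  rw [hc p (mem_affineExponents.1 hp)]
  split_ifs with h
  · obtain ⟨k, hk⟩ := Nat.exists_eq_add_of_le h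
    simp only [Matrix.cons_val_zero, Matrix.cons_val_one, Matrix.cons_val,
      MvPolynomial.algebraMap_eq]
    rw [mul_pow, mul_pow, ← pow_mul, hk, Nat.add_sub_cancel_left]
    have : (MvPolynomial.X 3 : MvPolynomial (Fin 4) ℂ) ^ 6 * MvPolynomial.X 3 ^ k =
        MvPolynomial.X 3 ^ p.1 * MvPolynomial.X 3 ^ (2 * p.2) := by
      rw [← pow_add, ← pow_add, hk]
    linear_combination MvPolynomial.C (c p) * MvPolynomial.X 0 ^ (6 - p.1 - p.2) *
      MvPolynomial.X 1 ^ p.1 * MvPolynomial.X 2 ^ p.2 * this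
  · rw [h0 p (by omega)]
    simp

/-- The chain rule for the blowup map `(s, x, y, t) ↦ (s, tx, t²y)`: differentiating in `x` or `y`
uses up one or two of the six powers of `t`. For `t ≠ 0` the two systems thus have corresponding
zeros. -/
lemma eval_strictSystem {G : MvPolynomial (Fin 3) ℂ} (hG : G.IsHomogeneous 6)
    {c : ℕ × ℕ → ℂ} (hc : ∀ p : ℕ × ℕ, p.1 + p.2 ≤ 6 →
      MvPolynomial.coeff (ternaryExponent (6 - p.1 - p.2) p.1 p.2) G = c p)
    (h0 : ∀ p : ℕ × ℕ, p.1 + 2 * p.2 < 6 → c p = 0) (p : Fin 4 → ℂ) :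
    p 3 ^ 6 * MvPolynomial.eval p (strictSystem c 0) =
      MvPolynomial.eval ![p 0, p 3 * p 1, p 3 ^ 2 * p 2] G ∧
    p 3 ^ 6 * MvPolynomial.eval p (strictSystem c 1) =
      MvPolynomial.eval ![p 0, p 3 * p 1, p 3 ^ 2 * p 2] (MvPolynomial.pderiv 0 G) ∧
    p 3 ^ 5 * MvPolynomial.eval p (strictSystem c 2) =
      MvPolynomial.eval ![p 0, p 3 * p 1, p 3 ^ 2 * p 2] (MvPolynomial.pderiv 1 G) ∧
    p 3 ^ 4 * MvPolynomial.eval p (strictSystem c 3) =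
      MvPolynomial.eval ![p 0, p 3 * p 1, p 3 ^ 2 * p 2] (MvPolynomial.pderiv 2 G) := by
  set φ : Fin 3 → MvPolynomial (Fin 4) ℂ := ![MvPolynomial.X 0,
      MvPolynomial.X 3 * MvPolynomial.X 1, MvPolynomial.X 3 ^ 2 * MvPolynomial.X 2] with hφ
  have key : MvPolynomial.X 3 ^ 6 * strictTransform c = MvPolynomial.aeval φ G :=
    X_pow_mul_strictTransform hG hc h0
  have hev : ∀ P : MvPolynomial (Fin 3) ℂ, MvPolynomial.eval p (MvPolynomial.aeval φ P) =
      MvPolynomial.eval ![p 0, p 3 * p 1, p 3 ^ 2 * p 2] P := by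
    intro P
    have := DFunLike.congr_fun (MvPolynomial.comp_aeval φ (MvPolynomial.aeval (R := ℂ) p)) P
    rw [AlgHom.comp_apply, MvPolynomial.aeval_eq_eval, MvPolynomial.aeval_eq_eval] at this
    refine this.trans ?_
    congr 2
    ext i
    fin_cases i <;> simp [φ]
  have hX : (MvPolynomial.X 3 : MvPolynomial (Fin 4) ℂ) ≠ 0 := MvPolynomial.X_ne_zero _
  have d : ∀ i : Fin 4, i ≠ 3 → MvPolynomial.X 3 ^ 6 * MvPolynomial.pderiv i (strictTransform c) =
      ∑ j, MvPolynomial.aeval φ (MvPolynomial.pderiv j G) * MvPolynomial.pderiv i (φ j) := by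
    intro i hi
    rw [← MvPolynomial.pderiv_aeval, ← key, MvPolynomial.pderiv_mul, MvPolynomial.pderiv_pow,
      MvPolynomial.pderiv_X_of_ne hi.symm]
    ring
  refine ⟨?_, ?_, ?_, ?_⟩
  · rw [← hev, ← key]
    simp [strictSystem]
  · have e := d 0 (by decide)
    simp only [Fin.sum_univ_three, hφ, Matrix.cons_val_zero, Matrix.cons_val_one, Matrix.cons_val,
      MvPolynomial.pderiv_mul, MvPolynomial.pderiv_pow, MvPolynomial.pderiv_X_self,
      MvPolynomial.pderiv_X_of_ne (show (1 : Fin 4) ≠ 0 by decide),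
      MvPolynomial.pderiv_X_of_ne (show (2 : Fin 4) ≠ 0 by decide),
      MvPolynomial.pderiv_X_of_ne (show (3 : Fin 4) ≠ 0 by decide), mul_zero, zero_mul, add_zero,
      mul_one] at e
    rw [← hev, hφ, ← e]
    simp [strictSystem]
  · have e := d 1 (by decide)
    simp only [Fin.sum_univ_three, hφ, Matrix.cons_val_zero, Matrix.cons_val_one, Matrix.cons_val,
      MvPolynomial.pderiv_mul, MvPolynomial.pderiv_pow, MvPolynomial.pderiv_X_self,
      MvPolynomial.pderiv_X_of_ne (show (0 : Fin 4) ≠ 1 by decide),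
      MvPolynomial.pderiv_X_of_ne (show (2 : Fin 4) ≠ 1 by decide),
      MvPolynomial.pderiv_X_of_ne (show (3 : Fin 4) ≠ 1 by decide), mul_zero, zero_mul, add_zero,
      zero_add, mul_one] at e
    have e' : MvPolynomial.X 3 ^ 5 * MvPolynomial.pderiv 1 (strictTransform c) =
        MvPolynomial.aeval φ (MvPolynomial.pderiv 1 G) := by
      refine mul_left_cancel₀ hX ?_
      linear_combination e
    rw [← hev, ← e']
    simp [strictSystem]
  · have e := d 2 (by decide)
    simp only [Fin.sum_univ_three, hφ, Matrix.cons_val_zero, Matrix.cons_val_one, Matrix.cons_val,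
      MvPolynomial.pderiv_mul, MvPolynomial.pderiv_pow, MvPolynomial.pderiv_X_self,
      MvPolynomial.pderiv_X_of_ne (show (0 : Fin 4) ≠ 2 by decide),
      MvPolynomial.pderiv_X_of_ne (show (1 : Fin 4) ≠ 2 by decide),
      MvPolynomial.pderiv_X_of_ne (show (3 : Fin 4) ≠ 2 by decide), mul_zero, zero_mul, add_zero,
      zero_add, mul_one] at e
    have e' : MvPolynomial.X 3 ^ 4 * MvPolynomial.pderiv 2 (strictTransform c) =
        MvPolynomial.aeval φ (MvPolynomial.pderiv 2 G) := by
      refine mul_left_cancel₀ (pow_ne_zero 2 hX) ?_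
      linear_combination e
    rw [← hev, ← e']
    simp [strictSystem]

lemma exists_strictTransform_eq (c : ℕ × ℕ → ℂ) : ∃ R, strictTransform c =
    MvPolynomial.C (c (6, 0)) * MvPolynomial.X 1 ^ 6 +
    MvPolynomial.C (c (4, 1)) * (MvPolynomial.X 0 * MvPolynomial.X 1 ^ 4 * MvPolynomial.X 2) +
    MvPolynomial.C (c (2, 2)) *
      (MvPolynomial.X 0 ^ 2 * MvPolynomial.X 1 ^ 2 * MvPolynomial.X 2 ^ 2) +
    MvPolynomial.C (c (0, 3)) * (MvPolynomial.X 0 ^ 3 * MvPolynomial.X 2 ^ 3) +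
    MvPolynomial.X 3 * R := by
  -- The remaining terms have weight at least 7, so one factor `t` can be pulled out.
  refine ⟨∑ p ∈ sexticExponents.filter fun p => ¬ p.1 + 2 * p.2 = 6, MvPolynomial.C (c p) *
    (MvPolynomial.X 0 ^ (6 - p.1 - p.2) * MvPolynomial.X 1 ^ p.1 * MvPolynomial.X 2 ^ p.2 *
      MvPolynomial.X 3 ^ (p.1 + 2 * p.2 - 7)), ?_⟩
  rw [strictTransform, ← Finset.sum_filter_add_sum_filter_not _ fun p => p.1 + 2 * p.2 = 6]
  congr 1
  · have : (sexticExponents.filter fun p => p.1 + 2 * p.2 = 6) = {(6, 0), (4, 1), (2, 2), (0, 3)} := by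
      decide
    rw [this]
    simp [add_assoc]
  · rw [Finset.mul_sum]
    refine Finset.sum_congr rfl fun p hp => ?_
    rw [Finset.mem_filter, sexticExponents, Finset.mem_filter] at hp
    rw [show p.1 + 2 * p.2 - 6 = p.1 + 2 * p.2 - 7 + 1 by omega, pow_succ]
    ring

lemma eval_strictSystem_exceptional (c : ℕ × ℕ → ℂ) (s x y : ℂ) :
    MvPolynomial.eval ![s, x, y, 0] (strictSystem c 0) = c (6, 0) * x ^ 6 +
      c (4, 1) * s * x ^ 4 * y + c (2, 2) * s ^ 2 * x ^ 2 * y ^ 2 + c (0, 3) * s ^ 3 * y ^ 3 ∧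
    MvPolynomial.eval ![s, x, y, 0] (strictSystem c 1) = c (4, 1) * x ^ 4 * y +
      2 * c (2, 2) * s * x ^ 2 * y ^ 2 + 3 * c (0, 3) * s ^ 2 * y ^ 3 ∧
    MvPolynomial.eval ![s, x, y, 0] (strictSystem c 2) = 6 * c (6, 0) * x ^ 5 +
      4 * c (4, 1) * s * x ^ 3 * y + 2 * c (2, 2) * s ^ 2 * x * y ^ 2 ∧
    MvPolynomial.eval ![s, x, y, 0] (strictSystem c 3) = c (4, 1) * s * x ^ 4 +
      2 * c (2, 2) * s ^ 2 * x ^ 2 * y + 3 * c (0, 3) * s ^ 3 * y ^ 2 := by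
  obtain ⟨R, hR⟩ := exists_strictTransform_eq c
  simp only [strictSystem, hR, Matrix.cons_val_zero, Matrix.cons_val_one, Matrix.cons_val, map_add,
    map_mul, map_pow, MvPolynomial.eval_X, MvPolynomial.eval_C, zero_mul, add_zero,
    MvPolynomial.pderiv_mul, MvPolynomial.pderiv_pow, MvPolynomial.pderiv_C,
    MvPolynomial.pderiv_X, Pi.single_apply]
  refine ⟨?_, ?_, ?_, ?_⟩ <;> (try simp) <;> ring

/-- This trades the root count for equations that can be compared with the system on the exceptional
curve `t = 0`. -/
lemma encard_roots_cubic_eq_three_iff (a b c d : ℂ) :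
    {z : ℂ | a + b * z + c * z ^ 2 + d * z ^ 3 = 0}.encard = (3 : ℕ) ↔
      d ≠ 0 ∧ ∀ z, a + b * z + c * z ^ 2 + d * z ^ 3 = 0 → b + 2 * c * z + 3 * d * z ^ 2 ≠ 0 := by
  set p : Polynomial ℂ := Polynomial.C a + Polynomial.C b * Polynomial.X +
    Polynomial.C c * Polynomial.X ^ 2 + Polynomial.C d * Polynomial.X ^ 3 with hp
  have hev : ∀ z, a + b * z + c * z ^ 2 + d * z ^ 3 = p.eval z := fun z => by simp [hp]
  have hder : ∀ z, b + 2 * c * z + 3 * d * z ^ 2 = p.derivative.eval z := fun z => by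
    simp [hp]; ring
  have hd : p.coeff 3 = d := by simp [hp]
  have hdeg : p.natDegree ≤ 3 := by rw [hp]; compute_degree
  simp only [hev, hder]
  constructor
  · intro h
    obtain ⟨h0, h1, h2⟩ := Polynomial.simple_roots_of_encard hdeg h
    refine ⟨?_, h2⟩
    rw [← hd, ← h1]
    exact Polynomial.leadingCoeff_ne_zero.2 h0
  · rintro ⟨h0, h2⟩
    have hp0 : p ≠ 0 := by
      intro h
      rw [h, Polynomial.coeff_zero] at hd
      exact h0 hd.symm
    have hnat : p.natDegree = 3 :=
      le_antisymm hdeg (Polynomial.le_natDegree_of_ne_zero (by rwa [hd]))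
    have hset : {z : ℂ | p.eval z = 0} = (p.roots.toFinset : Set ℂ) := by
      ext z
      simp [hp0]
    have hnd : p.roots.Nodup := by
      rw [Multiset.nodup_iff_count_le_one]
      intro z
      rw [Polynomial.count_roots]
      by_contra! hlt
      obtain ⟨hz, hz'⟩ := (Polynomial.one_lt_rootMultiplicity_iff_isRoot hp0).1 hlt
      exact h2 z hz hz'
    rw [hset, Set.encard_coe_eq_coe_finsetCard, Multiset.toFinset_card_of_nodup hnd,
      ← (IsAlgClosed.splits p).natDegree_eq_card_roots, hnat]

lemma tmConditions_three_iff (a : ℕ → ℕ → ℂ) :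
    TmConditions 3 a ↔ (∀ μ ν, μ + 2 * ν < 6 → a μ ν = 0) ∧ a 0 3 ≠ 0 ∧
      ∀ z, a 6 0 + a 4 1 * z + a 2 2 * z ^ 2 + a 0 3 * z ^ 3 = 0 →
        a 4 1 + 2 * a 2 2 * z + 3 * a 0 3 * z ^ 2 ≠ 0 := by
  rw [TmConditions, ← encard_roots_cubic_eq_three_iff]
  have : ∀ z : ℂ, ∑ p ∈ Finset.HasAntidiagonal.antidiagonal 3, a (2 * p.1) p.2 * z ^ p.2 =
      a 6 0 + a 4 1 * z + a 2 2 * z ^ 2 + a 0 3 * z ^ 3 := by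
    intro z
    simp [Finset.Nat.antidiagonal_succ]
    ring
  simp only [this]

/-- Off `t = 0` the system describes the singular points of the sextic away from `A`. On `t = 0` it
describes the multiple zeros of the part of weight 6; as the derivative in `t` is not included,
these are the points where the strict transform is singular or tangent to the exceptional curve.
Excluding them is condition (ii). -/
theorem isT3Sextic_iff_isStrictlySmooth {A : Projectivization ℂ (Fin 3 → ℂ)}
    {Λ : Submodule ℂ (Fin 3 → ℂ)} {e : Module.Basis (Fin 3) ℂ (Fin 3 → ℂ)} (he : IsAdapted e A Λ)
    {F : MvPolynomial (Fin 3) ℂ} (hF : F.IsHomogeneous 6)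
    (hL : ∀ μ ν, μ + 2 * ν < 6 → affineCoeff e F μ ν = 0) :
    IsT3Sextic F A Λ ↔ IsStrictlySmooth fun p => affineCoeff e F p.1 p.2 := by
  set c : ℕ × ℕ → ℂ := fun p => affineCoeff e F p.1 p.2 with hc
  have hG := hF.toCoords e
  have hsys := eval_strictSystem hG (c := c)
    (fun p hp => by rw [hc]; simp only; rw [affineCoeff_eq e hF, if_pos hp]) (fun p hp => hL _ _ hp)
  constructor
  · intro h p hp
    by_contra hcon
    rw [not_or] at hcon
    have hsing := ((singularLocus_eq_singleton_iff he hF).1 h.singularLocus_eq).2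
    have hT := (tmConditions_three_iff _).1 ((hasTmSingularity_iff he le_rfl hF).1 h.hasTmSingularity)
    by_cases ht : p 3 = 0
    · have hs : p 0 ≠ 0 := fun h => hcon.2 ⟨h, ht⟩
      have hp' : p = ![p 0, p 1, p 2, 0] := by
        ext i; fin_cases i <;> simp [ht]
      have h0 := hp 0
      have h3 := hp 3
      rw [hp', (eval_strictSystem_exceptional c _ _ _).1] at h0
      rw [hp', (eval_strictSystem_exceptional c _ _ _).2.2.2] at h3
      by_cases hx : p 1 = 0
      · have hy : p 2 ≠ 0 := fun h => hcon.1 ⟨hx, h⟩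
        rw [hx] at h0
        apply hT.2.1
        have : c (0, 3) * (p 0 ^ 3 * p 2 ^ 3) = 0 := by linear_combination h0
        exact (mul_eq_zero.1 this).resolve_right
          (mul_ne_zero (pow_ne_zero _ hs) (pow_ne_zero _ hy))
      -- `sy/x²` is the affine coordinate on the exceptional curve that corresponds to `z`.
      · refine hT.2.2 (p 0 * p 2 / p 1 ^ 2) ?_ ?_
        · change c (6, 0) + c (4, 1) * _ + c (2, 2) * _ + c (0, 3) * _ = 0
          field_simp
          linear_combination h0
        · change c (4, 1) + 2 * c (2, 2) * _ + 3 * c (0, 3) * _ = 0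
          have : p 0 * (c (4, 1) * p 1 ^ 4 + 2 * c (2, 2) * p 0 * p 1 ^ 2 * p 2 +
            3 * c (0, 3) * p 0 ^ 2 * p 2 ^ 2) = 0 := by linear_combination h3
          have h4 := (mul_eq_zero.1 this).resolve_left hs
          field_simp
          linear_combination h4
    · have h1 := hsing ![p 0, p 3 * p 1, p 3 ^ 2 * p 2] (by
        intro h0
        have h1 := congrFun h0 1
        have h2 := congrFun h0 2
        simp [ht] at h1 h2
        exact hcon.1 ⟨h1, h2⟩) (by
        obtain ⟨e0, e1, e2, e3⟩ := hsys p
        refine ⟨by rw [← e0, hp, mul_zero], fun i => ?_⟩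
        fin_cases i
        · exact e1.symm.trans (by rw [hp, mul_zero])
        · exact e2.symm.trans (by rw [hp, mul_zero])
        · exact e3.symm.trans (by rw [hp, mul_zero]))
      simp [ht] at h1
      exact hcon.1 h1
  · intro h
    have hsing : ∀ v, v ≠ 0 → IsSingularAt (toCoords e F) v → v 1 = 0 ∧ v 2 = 0 := by
      intro v _ hv
      obtain ⟨e0, e1, e2, e3⟩ := hsys ![v 0, v 1, v 2, 1]
      have hv' : ![v 0, v 1, v 2] = v := by
        ext i; fin_cases i <;> rfl
      simp only [Matrix.cons_val_zero, Matrix.cons_val_one, Matrix.cons_val, one_pow, one_mul,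
        hv', hv.1, hv.2] at e0 e1 e2 e3
      have := h ![v 0, v 1, v 2, 1] (fun i => by
        fin_cases i
        · exact e0
        · exact e1
        · exact e2
        · exact e3)
      simpa using this
    refine ⟨hF, squarefree_of_toCoords (squarefree_of_isSingularAt hsing),
      (singularLocus_eq_singleton_iff he hF).2 ⟨?_, hsing⟩,
      (hasTmSingularity_iff he le_rfl hF).2 ((tmConditions_three_iff _).2 ⟨hL, ?_, ?_⟩)⟩
    · obtain ⟨e0, e1, e2, e3⟩ := hsys ![1, 0, 0, 0]
      simp at e0 e1 e2 e3
      refine ⟨e0.symm, fun i => ?_⟩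
      fin_cases i
      · exact e1.symm
      · exact e2.symm
      · exact e3.symm
    · intro h0
      have h0' : c (0, 3) = 0 := h0
      -- The point `z = ∞` of the exceptional curve, where only the `y³` term survives.
      obtain ⟨e0, e1, e2, e3⟩ := eval_strictSystem_exceptional c 1 0 1
      have := h ![1, 0, 1, 0] (fun i => by
        fin_cases i
        · exact e0.trans (by rw [h0']; ring)
        · exact e1.trans (by rw [h0']; ring)
        · exact e2.trans (by ring)
        · exact e3.trans (by rw [h0']; ring))
      simp at this
    · intro z hz hz'
      have hz0 : c (6, 0) + c (4, 1) * z + c (2, 2) * z ^ 2 + c (0, 3) * z ^ 3 = 0 := hz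
      have hz1 : c (4, 1) + 2 * c (2, 2) * z + 3 * c (0, 3) * z ^ 2 = 0 := hz'
      obtain ⟨e0, e1, e2, e3⟩ := eval_strictSystem_exceptional c 1 1 z
      have := h ![1, 1, z, 0] (fun i => by
        fin_cases i
        · exact e0.trans (by linear_combination hz0)
        · exact e1.trans (by linear_combination z * hz1)
        -- Euler's relation for weights 1 and 2: the derivative in `x` is determined by the value
        -- and the derivative in `y`.
        · exact e2.trans (by linear_combination 6 * hz0 - 2 * z * hz1)
        · exact e3.trans (by linear_combination hz1))
      simp at this

/-! ### Elimination in the Cox ring by determinants -/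

/-- The bidegrees of the variables of the Cox ring. -/
def coxWeight : Fin 4 → ℤ × ℤ := ![(1, 0), (1, 1), (1, 2), (0, -1)]

/-- The exponents of bidegree `(3 N, 2 N)`. -/
def coxExponents (N : ℕ) : Finset (Fin 4 →₀ ℕ) :=
  (Finset.Icc 0 (Finsupp.equivFunOnFinite.symm fun _ => 6 * N)).filter fun m =>
    m 0 + m 1 + m 2 = 3 * N ∧ m 1 + 2 * m 2 = m 3 + 2 * N

/-- The box of side `6 N` loses nothing: the equations bound the first three exponents by `3 N` and
the last by `4 N`. -/
lemma mem_coxExponents {N : ℕ} {m : Fin 4 →₀ ℕ} : m ∈ coxExponents N ↔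
    m 0 + m 1 + m 2 = 3 * N ∧ m 1 + 2 * m 2 = m 3 + 2 * N := by
  rw [coxExponents, Finset.mem_filter, and_iff_right_iff_imp]
  rintro ⟨h1, h2⟩
  rw [Finset.mem_Icc]
  refine ⟨fun _ => Nat.zero_le _, fun i => ?_⟩
  simp only [Finsupp.equivFunOnFinite_symm_apply_apply]
  fin_cases i <;> (simp; omega)

lemma weight_coxWeight (m : Fin 4 →₀ ℕ) : Finsupp.weight coxWeight m =
    ((m 0 : ℤ) + m 1 + m 2, (m 1 : ℤ) + 2 * m 2 - m 3) := by
  rw [Finsupp.weight_apply, Finsupp.sum_fintype _ _ (by simp), Fin.sum_univ_four]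
  ext <;> (simp [coxWeight]; try ring)

lemma weight_coxWeight_eq_iff (N : ℕ) (m : Fin 4 →₀ ℕ) :
    Finsupp.weight coxWeight m = (3 * (N : ℤ), 2 * (N : ℤ)) ↔ m ∈ coxExponents N := by
  rw [weight_coxWeight, mem_coxExponents, Prod.ext_iff]
  simp only
  omega

lemma isWeightedHomogeneous_strictTransform (c : ℕ × ℕ → ℂ) :
    (strictTransform c).IsWeightedHomogeneous coxWeight (6, 6) := by
  refine MvPolynomial.IsWeightedHomogeneous.sum _ _ _ fun p hp => ?_
  rw [sexticExponents, Finset.mem_filter, mem_affineExponents] at hp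
  refine MvPolynomial.IsWeightedHomogeneous.C_mul ?_ _
  have h : ∀ i k, MvPolynomial.IsWeightedHomogeneous coxWeight
      (MvPolynomial.X i ^ k : MvPolynomial (Fin 4) ℂ) (k • coxWeight i) := fun i k =>
    (MvPolynomial.isWeightedHomogeneous_X ℂ coxWeight i).pow k
  convert (((h 0 (6 - p.1 - p.2)).mul (h 1 p.1)).mul (h 2 p.2)).mul (h 3 (p.1 + 2 * p.2 - 6)) using 1
  ext <;> simp [coxWeight] <;> omega

lemma exists_isWeightedHomogeneous_strictSystem (c : ℕ × ℕ → ℂ) (i : Fin 4) :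
    ∃ n, (strictSystem c i).IsWeightedHomogeneous coxWeight n := by
  have h := isWeightedHomogeneous_strictTransform c
  fin_cases i
  · exact ⟨_, h⟩
  · exact ⟨(6, 6) - coxWeight 0, h.pderiv (sub_add_cancel _ _)⟩
  · exact ⟨(6, 6) - coxWeight 1, h.pderiv (sub_add_cancel _ _)⟩
  · exact ⟨(6, 6) - coxWeight 2, h.pderiv (sub_add_cancel _ _)⟩

lemma weightedHomogeneousComponent_mem_span_strictSystem (c : ℕ × ℕ → ℂ)
    {q : MvPolynomial (Fin 4) ℂ} (hq : q ∈ Ideal.span (Set.range (strictSystem c))) (n : ℤ × ℤ) :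
    MvPolynomial.weightedHomogeneousComponent coxWeight n q ∈
      Ideal.span (Set.range (strictSystem c)) := by
  let _ := MvPolynomial.weightedGradedAlgebra ℂ coxWeight
  refine MvPolynomial.weightedHomogeneousComponent_mem_of_mem ℂ coxWeight ?_ hq n
  refine Ideal.homogeneous_span _ _ ?_
  rintro _ ⟨i, rfl⟩
  exact exists_isWeightedHomogeneous_strictSystem c i

/-- The matrix of coefficients, in bidegree `(3 N, 2 N)`, of the combinations of the equations of
the singular points of the strict transform that are given by `h`. -/
def strictMatrix (N : ℕ) (h : coxExponents N → Fin 4 → MvPolynomial (Fin 4) ℂ) (c : ℕ × ℕ → ℂ) :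
    Matrix (coxExponents N) (coxExponents N) ℂ :=
  Matrix.of fun m m' => MvPolynomial.coeff (m' : Fin 4 →₀ ℕ) (∑ i, h m i * strictSystem c i)

lemma IsStrictlySmooth.exists_det_ne_zero {c : ℕ × ℕ → ℂ} (hc : IsStrictlySmooth c) :
    ∃ N h, (strictMatrix N h c).det ≠ 0 := by
  set J := Ideal.span (Set.range (strictSystem c))
  have hrad : ∀ a b : Fin 4, (a = 1 ∨ a = 2) → (b = 0 ∨ b = 3) →
      (MvPolynomial.X a * MvPolynomial.X b : MvPolynomial (Fin 4) ℂ) ∈ J.radical := by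
    intro a b ha hb
    rw [← MvPolynomial.vanishingIdeal_zeroLocus_eq_radical (K := ℂ),
      MvPolynomial.mem_vanishingIdeal_iff]
    intro p hp
    have h := hc p (fun i => by
      have := MvPolynomial.mem_zeroLocus_iff.1 hp _ (Ideal.subset_span ⟨i, rfl⟩)
      rwa [MvPolynomial.aeval_eq_eval] at this)
    rw [map_mul, MvPolynomial.aeval_X, MvPolynomial.aeval_X]
    rcases ha with rfl | rfl <;> rcases hb with rfl | rfl <;> rcases h with h | h <;> simp [h]
  -- One exponent serves all four products `xs`, `xt`, `ys`, `yt`.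
  obtain ⟨n, hn⟩ : ∃ n, ∀ a b : Fin 4, (a = 1 ∨ a = 2) → (b = 0 ∨ b = 3) →
      (MvPolynomial.X a * MvPolynomial.X b : MvPolynomial (Fin 4) ℂ) ^ n ∈ J := by
    choose! k hk using hrad
    refine ⟨∑ a, ∑ b, k a b, fun a b ha hb => J.pow_mem_of_pow_mem (hk a b ha hb) ?_⟩
    exact (Finset.single_le_sum (f := fun b => k a b) (fun _ _ => Nat.zero_le _)
      (Finset.mem_univ b)).trans (Finset.single_le_sum (f := fun a => ∑ b, k a b)
        (fun _ _ => Nat.zero_le _) (Finset.mem_univ a))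
  -- In bidegree `(6n, 4n)` one of `x`, `y` and one of `s`, `t` must occur to a power at least `n`,
  -- so every monomial is a multiple of the `n`-th power of one of the four products.
  have hmem : ∀ m : coxExponents (2 * n), MvPolynomial.monomial (m : Fin 4 →₀ ℕ) (1 : ℂ) ∈ J := by
    rintro ⟨m, hm⟩
    rw [mem_coxExponents] at hm
    obtain ⟨a, ha, ha'⟩ : ∃ a : Fin 4, (a = 1 ∨ a = 2) ∧ n ≤ m a := by
      by_cases h : n ≤ m 1
      · exact ⟨1, Or.inl rfl, h⟩
      · exact ⟨2, Or.inr rfl, by omega⟩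
    obtain ⟨b, hb, hb'⟩ : ∃ b : Fin 4, (b = 0 ∨ b = 3) ∧ n ≤ m b := by
      by_cases h : n ≤ m 0
      · exact ⟨0, Or.inl rfl, h⟩
      · exact ⟨3, Or.inr rfl, by omega⟩
    have hab : a ≠ b := by
      rcases ha with rfl | rfl <;> rcases hb with rfl | rfl <;> decide
    refine Ideal.mem_of_dvd _ ?_ (hn a b ha hb)
    rw [mul_pow, MvPolynomial.X_pow_eq_monomial, MvPolynomial.X_pow_eq_monomial,
      MvPolynomial.monomial_mul, one_mul, MvPolynomial.monomial_dvd_monomial]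
    refine ⟨Or.inr fun i => ?_, one_dvd _⟩
    rw [Finsupp.add_apply, Finsupp.single_apply, Finsupp.single_apply]
    change _ ≤ m i
    split_ifs with h1 h2 h2
    · exact absurd (h1.trans h2.symm) hab
    · rw [← h1]; omega
    · rw [← h2]; omega
    · omega
  choose h hh using fun m => Ideal.mem_span_range_iff_exists_fun.1 (hmem m)
  refine ⟨2 * n, h, ?_⟩
  have : strictMatrix (2 * n) h c = 1 := by
    ext m m'
    rw [strictMatrix, Matrix.of_apply, hh, MvPolynomial.coeff_monomial, Matrix.one_apply]
    simp only [Subtype.ext_iff]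
  rw [this, Matrix.det_one]
  exact one_ne_zero

lemma isStrictlySmooth_of_det_ne_zero {c : ℕ × ℕ → ℂ} {N : ℕ}
    {h : coxExponents N → Fin 4 → MvPolynomial (Fin 4) ℂ} (hdet : (strictMatrix N h c).det ≠ 0) :
    IsStrictlySmooth c := by
  intro p hp
  set J := Ideal.span (Set.range (strictSystem c))
  have hJ : ∀ q ∈ J, MvPolynomial.eval p q = 0 := by
    intro q hq
    have : J ≤ RingHom.ker (MvPolynomial.eval p) := by
      rw [Ideal.span_le]
      rintro _ ⟨i, rfl⟩
      exact hp i
    exact this hq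
  have hmon : ∀ m : coxExponents N, MvPolynomial.monomial (m : Fin 4 →₀ ℕ) (1 : ℂ) ∈ J := by
    intro m
    -- The row of the inverse matrix that belongs to `m` combines the rows into an element of `J`
    -- whose component of bidegree `(3N, 2N)` is the monomial `m`; as `J` is bihomogeneous, it
    -- contains that component.
    set v : coxExponents N → ℂ := Matrix.vecMul (Pi.single m 1) (strictMatrix N h c)⁻¹ with hv
    have hvM : Matrix.vecMul v (strictMatrix N h c) = Pi.single m 1 := by
      rw [hv, Matrix.vecMul_vecMul, Matrix.nonsing_inv_mul _ (isUnit_iff_ne_zero.2 hdet),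
        Matrix.vecMul_one]
    set q : MvPolynomial (Fin 4) ℂ :=
      ∑ k, MvPolynomial.C (v k) * ∑ i, h k i * strictSystem c i with hq
    have hqJ : q ∈ J := Ideal.sum_mem _ fun k _ => Ideal.mul_mem_left _ _ <|
      Ideal.sum_mem _ fun i _ => Ideal.mul_mem_left _ _ (Ideal.subset_span ⟨i, rfl⟩)
    have hcoeff : ∀ m' : coxExponents N, MvPolynomial.coeff (m' : Fin 4 →₀ ℕ) q =
        (Pi.single m 1 : coxExponents N → ℂ) m' := by
      intro m'
      rw [← hvM, hq, MvPolynomial.coeff_sum]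
      simp only [MvPolynomial.coeff_C_mul]
      rfl
    have hcomp : MvPolynomial.weightedHomogeneousComponent coxWeight (3 * (N : ℤ), 2 * (N : ℤ)) q =
        MvPolynomial.monomial (m : Fin 4 →₀ ℕ) 1 := by
      ext m'
      rw [MvPolynomial.coeff_weightedHomogeneousComponent, MvPolynomial.coeff_monomial]
      simp only [weight_coxWeight_eq_iff]
      split_ifs with h1 h2 h2
      · rw [hcoeff ⟨m', h1⟩, show (⟨m', h1⟩ : coxExponents N) = m from Subtype.ext h2.symm]
        simp
      · rw [hcoeff ⟨m', h1⟩, Pi.single_eq_of_ne]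
        exact fun h3 => h2 (Subtype.ext_iff.1 h3).symm
      · exact absurd (h2 ▸ m.2) h1
      · rfl
    rw [← hcomp]
    exact weightedHomogeneousComponent_mem_span_strictSystem c hqJ _
  have hzero : ∀ k i j l : ℕ, k + i + j = 3 * N → i + 2 * j = l + 2 * N →
      p 0 ^ k * p 1 ^ i * p 2 ^ j * p 3 ^ l = 0 := by
    intro k i j l h1 h2
    set m : Fin 4 →₀ ℕ := Finsupp.equivFunOnFinite.symm ![k, i, j, l] with hm
    have hmem : m ∈ coxExponents N := by
      rw [mem_coxExponents]
      exact ⟨h1, h2⟩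
    have := hJ _ (hmon ⟨m, hmem⟩)
    rw [MvPolynomial.eval_monomial, Finsupp.prod_fintype _ _ (by simp), Fin.prod_univ_four,
      one_mul] at this
    exact this
  -- The bidegree `(3, 2)` lies strictly between those of `s` and `x`, so for each choice of one of
  -- `x`, `y` and one of `s`, `t` there is a monomial of bidegree `(3N, 2N)` in these two variables
  -- alone.
  by_contra hcon
  rw [not_or, not_and_or, not_and_or] at hcon
  obtain ⟨ha | ha, hb | hb⟩ := hcon
  · have := hzero N (2 * N) 0 0 (by ring) (by ring)
    simp [ha, hb] at this
  · have := hzero 0 (3 * N) 0 N (by ring) (by ring)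
    simp [ha, hb] at this
  · have := hzero (2 * N) 0 N 0 (by ring) (by ring)
    simp [ha, hb] at this
  · have := hzero 0 0 (3 * N) (4 * N) (by ring) (by ring)
    simp [ha, hb] at this

theorem isStrictlySmooth_iff_exists_det_ne_zero (c : ℕ × ℕ → ℂ) :
    IsStrictlySmooth c ↔ ∃ N h, (strictMatrix N h c).det ≠ 0 :=
  ⟨fun hc => hc.exists_det_ne_zero, fun ⟨_, _, h⟩ => isStrictlySmooth_of_det_ne_zero h⟩

/-- The locus where some determinant of linear forms of a given family does not vanish is open. -/
lemma isZariskiOpen_exists_det_ne_zero {W : Type*} [AddCommGroup W] [Module ℂ W] {κ : Type*}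
    (n : κ → Type*) [∀ k, Fintype (n k)] [∀ k, DecidableEq (n k)]
    (M : ∀ k, Matrix (n k) (n k) (Module.Dual ℂ W)) :
    IsZariskiOpen {x : Projectivization ℂ W | ∃ k, ((M k).map fun φ => φ x.rep).det ≠ 0} := by
  refine ⟨Set.range fun k => ((M k).map MvPolynomial.X).det, ?_, ?_⟩
  · rintro _ ⟨k, rfl⟩
    refine ⟨Fintype.card (n k), ?_⟩
    beta_reduce
    rw [Matrix.det_apply]
    refine MvPolynomial.IsHomogeneous.sum _ _ _ fun σ _ => ?_
    have h : (∏ i, (M k).map (MvPolynomial.X (R := ℂ)) (σ i) i).IsHomogeneous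
        (∑ _i : n k, 1) :=
      MvPolynomial.IsHomogeneous.prod _ _ _ fun i _ => MvPolynomial.isHomogeneous_X _ _
    rw [Finset.sum_const, Finset.card_univ, smul_eq_mul, mul_one] at h
    rcases Int.units_eq_one_or (Equiv.Perm.sign σ) with hs | hs
    · rw [hs, one_smul]; exact h
    · rw [hs, Units.neg_smul, one_smul]; exact h.neg
  · ext x
    simp only [Set.mem_compl_iff, Set.mem_ofPred_eq, Set.forall_mem_range, not_forall]
    refine exists_congr fun k => not_congr ?_
    rw [RingHom.map_det]
    have : (MvPolynomial.eval fun φ : Module.Dual ℂ W => φ x.rep).mapMatrix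
        ((M k).map MvPolynomial.X) = (M k).map fun φ => φ x.rep := by
      ext i j
      simp
    rw [this]

/-- Linearity of the system in `c` makes the entries of `strictMatrix` linear forms on the space of
sextics. -/
lemma strictSystem_add (c c' : ℕ × ℕ → ℂ) (i : Fin 4) :
    strictSystem (c + c') i = strictSystem c i + strictSystem c' i := by
  have h : strictTransform (c + c') = strictTransform c + strictTransform c' := by
    simp only [strictTransform, Pi.add_apply, map_add, add_mul, Finset.sum_add_distrib]
  fin_cases i <;> simp [strictSystem, h]

lemma strictSystem_smul (a : ℂ) (c : ℕ × ℕ → ℂ) (i : Fin 4) :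
    strictSystem (a • c) i = a • strictSystem c i := by
  have h : strictTransform (a • c) = a • strictTransform c := by
    simp only [strictTransform, Pi.smul_apply, smul_eq_mul, map_mul, mul_assoc, Finset.smul_sum,
      MvPolynomial.smul_eq_C_mul]
  fin_cases i <;> simp [strictSystem, h]

/-- The affine coefficients of a form, as a linear map. -/
def affineCoeffs (e : Module.Basis (Fin 3) ℂ (Fin 3 → ℂ)) :
    MvPolynomial (Fin 3) ℂ →ₗ[ℂ] (ℕ × ℕ → ℂ) where
  toFun F p := affineCoeff e F p.1 p.2
  map_add' F G := by
    ext p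
    simp only [affineCoeff, affineEquation, map_add, MvPolynomial.coeff_add, Pi.add_apply]
  map_smul' a F := by
    ext p
    simp only [affineCoeff, affineEquation, map_smul, MvPolynomial.coeff_smul, Pi.smul_apply,
      RingHom.id_apply]

/-- The entries of `strictMatrix`, as linear forms on the space of ternary sextics. -/
def strictMatrixForm (e : Module.Basis (Fin 3) ℂ (Fin 3 → ℂ)) (N : ℕ)
    (h : coxExponents N → Fin 4 → MvPolynomial (Fin 4) ℂ) :
    Matrix (coxExponents N) (coxExponents N) (Module.Dual ℂ (Forms 6)) :=
  Matrix.of fun m m' =>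
    { toFun := fun F => strictMatrix N h (affineCoeffs e F) m m'
      map_add' := fun F G => by
        simp only [strictMatrix, Matrix.of_apply, Submodule.coe_add, map_add, strictSystem_add,
          mul_add, Finset.sum_add_distrib, MvPolynomial.coeff_add]
      map_smul' := fun a F => by
        simp only [strictMatrix, Matrix.of_apply, Submodule.coe_smul, map_smul, strictSystem_smul,
          mul_smul_comm, ← Finset.smul_sum, MvPolynomial.coeff_smul, RingHom.id_apply] }

/-! ### The linear system, an explicit sextic, and openness -/

/-- The form of degree `d` whose affine coefficients are given. -/
def formOfCoeffs (e : Module.Basis (Fin 3) ℂ (Fin 3 → ℂ)) (d : ℕ) (c : ℕ × ℕ → ℂ) :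
    MvPolynomial (Fin 3) ℂ :=
  ofCoords e (∑ p ∈ affineExponents d,
    MvPolynomial.monomial (ternaryExponent (d - p.1 - p.2) p.1 p.2) (c p))

lemma isHomogeneous_formOfCoeffs (e : Module.Basis (Fin 3) ℂ (Fin 3 → ℂ)) (d : ℕ)
    (c : ℕ × ℕ → ℂ) : (formOfCoeffs e d c).IsHomogeneous d := by
  refine MvPolynomial.IsHomogeneous.ofCoords ?_ e
  refine MvPolynomial.IsHomogeneous.sum _ _ _ fun p hp => ?_
  rw [mem_affineExponents] at hp
  refine MvPolynomial.isHomogeneous_monomial _ ?_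
  rw [Finsupp.degree_eq_sum, Fin.sum_univ_three]
  simp only [ternaryExponent_zero, ternaryExponent_one, ternaryExponent_two]
  omega

lemma affineCoeff_formOfCoeffs (e : Module.Basis (Fin 3) ℂ (Fin 3 → ℂ)) {d : ℕ} (c : ℕ × ℕ → ℂ)
    {μ ν : ℕ} (h : μ + ν ≤ d) : affineCoeff e (formOfCoeffs e d c) μ ν = c (μ, ν) := by
  rw [affineCoeff_eq e (isHomogeneous_formOfCoeffs e d c), if_pos h, formOfCoeffs,
    toCoords_ofCoords, MvPolynomial.coeff_sum, Finset.sum_eq_single (μ, ν)]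
  · rw [MvPolynomial.coeff_monomial, if_pos rfl]
  · intro p _ hp
    rw [MvPolynomial.coeff_monomial, if_neg]
    intro h
    apply hp
    have h1 := DFunLike.congr_fun h 1
    have h2 := DFunLike.congr_fun h 2
    simp only [ternaryExponent_one, ternaryExponent_two] at h1 h2
    exact Prod.ext h1 h2
  · intro h'
    exact absurd (mem_affineExponents.2 h) h'

lemma eq_zero_of_affineCoeff_eq_zero {e : Module.Basis (Fin 3) ℂ (Fin 3 → ℂ)} {d : ℕ}
    {F : MvPolynomial (Fin 3) ℂ} (hF : F.IsHomogeneous d)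
    (h : ∀ μ ν, μ + ν ≤ d → affineCoeff e F μ ν = 0) : F = 0 := by
  rw [← ofCoords_toCoords e F, (hF.toCoords e).eq_sum_affineExponents, Finset.sum_eq_zero, map_zero]
  intro p hp
  rw [mem_affineExponents] at hp
  have := h p.1 p.2 hp
  rw [affineCoeff_eq e hF, if_pos hp] at this
  rw [this, MvPolynomial.monomial_zero]

/-- The sextics whose affine coefficients of weight less than `6` vanish. -/
def weightedSextics (e : Module.Basis (Fin 3) ℂ (Fin 3 → ℂ)) : Submodule ℂ (Forms 6) where
  carrier := {F | ∀ μ ν, μ + 2 * ν < 6 → affineCoeffs e F (μ, ν) = 0}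
  zero_mem' μ ν _ := by simp
  add_mem' {F G} hF hG μ ν h := by
    rw [Submodule.coe_add, map_add, Pi.add_apply, hF μ ν h, hG μ ν h, add_zero]
  smul_mem' a F hF μ ν h := by
    rw [Submodule.coe_smul, map_smul, Pi.smul_apply, hF μ ν h, smul_zero]

/-- Of the 28 coefficients of a sextic, the `6 + 4 + 2 = 12` of weight less than 6 vanish, and the
others are free. -/
lemma finrank_weightedSextics (e : Module.Basis (Fin 3) ℂ (Fin 3 → ℂ)) :
    Module.finrank ℂ (weightedSextics e) = 16 := by
  let T : weightedSextics e →ₗ[ℂ] (sexticExponents → ℂ) :=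
    LinearMap.pi fun p => (LinearMap.proj (p : ℕ × ℕ)).comp
      ((affineCoeffs e).comp ((Forms 6).subtype.comp (weightedSextics e).subtype))
  have hT : ∀ F p, T F p = affineCoeff e F.1.1 p.1.1 p.1.2 := fun F p => rfl
  have hbij : Function.Bijective T := by
    constructor
    · rw [injective_iff_map_eq_zero]
      rintro ⟨⟨F, hF⟩, hL⟩ h0
      have : F = 0 := by
        refine eq_zero_of_affineCoeff_eq_zero (e := e) hF fun μ ν h => ?_
        by_cases hw : μ + 2 * ν < 6
        · exact hL μ ν hw
        · have := congrFun h0 ⟨(μ, ν), by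
            rw [sexticExponents, Finset.mem_filter, mem_affineExponents]
            exact ⟨h, not_lt.1 hw⟩⟩
          rwa [hT] at this
      subst this
      rfl
    · intro v
      let c : ℕ × ℕ → ℂ := fun p => if hp : p ∈ sexticExponents then v ⟨p, hp⟩ else 0
      refine ⟨⟨⟨formOfCoeffs e 6 c, isHomogeneous_formOfCoeffs e 6 c⟩, fun μ ν h => ?_⟩, ?_⟩
      · change affineCoeff e (formOfCoeffs e 6 c) μ ν = 0
        rw [affineCoeff_formOfCoeffs e c (by omega)]
        refine dif_neg fun h' => ?_
        rw [sexticExponents, Finset.mem_filter] at h'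
        exact absurd h (not_lt.2 h'.2)
      · ext p
        have hp := mem_affineExponents.1 (Finset.mem_filter.1 p.2).1
        rw [hT, affineCoeff_formOfCoeffs e c hp]
        exact dif_pos p.2
  rw [(LinearEquiv.ofBijective T hbij).finrank_eq, Module.finrank_fintype_fun_eq_card,
    Fintype.card_coe]
  decide

/-- The sextic `s³y³ + x⁶ + y⁶` is a `t₃`-sextic. -/
lemma exists_isT3Sextic {A : Projectivization ℂ (Fin 3 → ℂ)} {Λ : Submodule ℂ (Fin 3 → ℂ)}
    {e : Module.Basis (Fin 3) ℂ (Fin 3 → ℂ)} (he : IsAdapted e A Λ) :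
    ∃ F : MvPolynomial (Fin 3) ℂ, F.IsHomogeneous 6 ∧ F ≠ 0 ∧ IsT3Sextic F A Λ := by
  let c : ℕ × ℕ → ℂ := fun p => if p = (0, 3) ∨ p = (6, 0) ∨ p = (0, 6) then 1 else 0
  have hF := isHomogeneous_formOfCoeffs e 6 c
  have hcoeff : ∀ μ ν, affineCoeff e (formOfCoeffs e 6 c) μ ν = c (μ, ν) := by
    intro μ ν
    by_cases h : μ + ν ≤ 6
    · exact affineCoeff_formOfCoeffs e c h
    · rw [affineCoeff_eq e hF, if_neg h]
      refine (if_neg ?_).symm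
      simp only [Prod.mk.injEq]
      omega
  refine ⟨formOfCoeffs e 6 c, hF, ?_, ?_⟩
  · intro h0
    have := hcoeff 0 3
    rw [h0] at this
    simp [c, affineCoeff, affineEquation] at this
  · rw [isT3Sextic_iff_isStrictlySmooth he hF]
    · have hst : strictTransform c = MvPolynomial.X 0 ^ 3 * MvPolynomial.X 2 ^ 3 +
          MvPolynomial.X 1 ^ 6 + MvPolynomial.X 2 ^ 6 * MvPolynomial.X 3 ^ 6 := by
        rw [strictTransform, ← Finset.sum_subset (s₁ := {(0, 3), (6, 0), (0, 6)}) (by decide)]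
        · simp [c, add_assoc]
        · intro p _ hp
          have : c p = 0 := if_neg (by simpa using hp)
          simp [this]
      simp only [hcoeff]
      intro p hp
      have h1 := hp 1
      have h2 := hp 2
      have h3 := hp 3
      change MvPolynomial.eval p (MvPolynomial.pderiv 0 (strictTransform c)) = 0 at h1
      change MvPolynomial.eval p (MvPolynomial.pderiv 1 (strictTransform c)) = 0 at h2
      change MvPolynomial.eval p (MvPolynomial.pderiv 2 (strictTransform c)) = 0 at h3
      simp [hst, MvPolynomial.pderiv_X] at h1 h2 h3
      -- The derivatives are multiples of `s²y³`, `x⁵` and a form that reduces to a multiple of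
      -- `y⁵t⁶` when `s = 0`. So `x = 0`, and `y ≠ 0` forces `s = t = 0`.
      by_cases hy : p 2 = 0
      · exact Or.inl ⟨h2, hy⟩
      · have h0 : p 0 = 0 := h1.resolve_left hy
        right
        refine ⟨h0, ?_⟩
        simpa [h0, hy] using h3
    · intro μ ν h
      rw [hcoeff]
      refine if_neg ?_
      simp only [Prod.mk.injEq]
      omega

theorem t3Sextics_eq {A : Projectivization ℂ (Fin 3 → ℂ)} {Λ : Submodule ℂ (Fin 3 → ℂ)}
    {e : Module.Basis (Fin 3) ℂ (Fin 3 → ℂ)} (he : IsAdapted e A Λ) :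
    t3Sextics A Λ = projSubspace (weightedSextics e) ∩
      {x | ∃ k : Σ N, coxExponents N → Fin 4 → MvPolynomial (Fin 4) ℂ,
        ((strictMatrixForm e k.1 k.2).map fun φ => φ x.rep).det ≠ 0} := by
  ext x
  have hF : (x.rep : MvPolynomial (Fin 3) ℂ).IsHomogeneous 6 := x.rep.2
  have hL : x ∈ projSubspace (weightedSextics e) ↔
      ∀ μ ν, μ + 2 * ν < 6 → affineCoeff e x.rep μ ν = 0 := by
    rw [projSubspace, Set.mem_ofPred_eq, Projectivization.submodule_eq,
      Submodule.span_singleton_le_iff_mem]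
    rfl
  have hU : (∃ k : Σ N, coxExponents N → Fin 4 → MvPolynomial (Fin 4) ℂ,
      ((strictMatrixForm e k.1 k.2).map fun φ => φ x.rep).det ≠ 0) ↔
      IsStrictlySmooth (affineCoeffs e x.rep) := by
    rw [isStrictlySmooth_iff_exists_det_ne_zero, Sigma.exists]
    rfl
  rw [Set.mem_inter_iff, hL, Set.mem_ofPred_eq, hU]
  constructor
  · intro h
    have h0 : IsT3Sextic (x.rep : MvPolynomial (Fin 3) ℂ) A Λ := h
    have hw := ((hasTmSingularity_iff he le_rfl hF).1 h0.hasTmSingularity).1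
    exact ⟨hw, (isT3Sextic_iff_isStrictlySmooth he hF hw).1 h0⟩
  · rintro ⟨hw, hs⟩
    exact (isT3Sextic_iff_isStrictlySmooth he hF hw).2 hs

/-- Membership in `t3Sextics` is tested on a chosen representative, which is only known to be a
nonzero multiple of a given form. -/
lemma isT3Sextic_smul {A : Projectivization ℂ (Fin 3 → ℂ)} {Λ : Submodule ℂ (Fin 3 → ℂ)}
    {e : Module.Basis (Fin 3) ℂ (Fin 3 → ℂ)} (he : IsAdapted e A Λ) {F : MvPolynomial (Fin 3) ℂ}
    (hF : F.IsHomogeneous 6) (h : IsT3Sextic F A Λ) {a : ℂ} (ha : a ≠ 0) :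
    IsT3Sextic (a • F) A Λ := by
  have hw := ((hasTmSingularity_iff he le_rfl hF).1 h.hasTmSingularity).1
  have hs := (isT3Sextic_iff_isStrictlySmooth he hF hw).1 h
  have haF : (a • F).IsHomogeneous 6 := (Forms 6).smul_mem a hF
  have hcoeff : ∀ μ ν, affineCoeff e (a • F) μ ν = a * affineCoeff e F μ ν := fun μ ν =>
    congrFun ((affineCoeffs e).map_smul a F) (μ, ν)
  rw [isT3Sextic_iff_isStrictlySmooth he haF fun μ ν hlt => by rw [hcoeff, hw μ ν hlt, mul_zero]]
  intro p hp
  refine hs p fun i => ?_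
  have h1 := hp i
  simp only [hcoeff] at h1
  change MvPolynomial.eval p (strictSystem (a • fun p : ℕ × ℕ => affineCoeff e F p.1 p.2) i) = 0
    at h1
  rw [strictSystem_smul, MvPolynomial.smul_eval, mul_eq_zero, or_iff_right ha] at h1
  exact h1

lemma t3Sextics_nonempty {A : Projectivization ℂ (Fin 3 → ℂ)} {Λ : Submodule ℂ (Fin 3 → ℂ)}
    {e : Module.Basis (Fin 3) ℂ (Fin 3 → ℂ)} (he : IsAdapted e A Λ) :
    (t3Sextics A Λ).Nonempty := by
  obtain ⟨F, hF, hF0, hT⟩ := exists_isT3Sextic he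
  have h0 : (⟨F, hF⟩ : Forms 6) ≠ 0 := fun h => hF0 (congrArg Subtype.val h)
  refine ⟨Projectivization.mk ℂ _ h0, ?_⟩
  obtain ⟨a, ha⟩ := Projectivization.exists_smul_eq_mk_rep ℂ _ h0
  change IsT3Sextic ((Projectivization.mk ℂ _ h0).rep : MvPolynomial (Fin 3) ℂ) A Λ
  rw [← ha]
  exact isT3Sextic_smul he hF hT a.ne_zero

end

theorem proposition5 (A : Projectivization ℂ (Fin 3 → ℂ)) (Λ : Submodule ℂ (Fin 3 → ℂ))
    (hΛ : Module.finrank ℂ Λ = 2) (hA : A.submodule ≤ Λ) :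
    (∀ (e : Module.Basis (Fin 3) ℂ (Fin 3 → ℂ)), PlaneCurve.IsAdapted e A Λ →
      ∀ (m d : ℕ), 1 ≤ m → 2 * m ≤ d →
      ∀ F : MvPolynomial (Fin 3) ℂ, F.IsHomogeneous d →
        (PlaneCurve.HasTmSingularity m F A Λ ↔
          (∀ μ ν : ℕ, μ + 2 * ν < 2 * m → PlaneCurve.affineCoeff e F μ ν = 0) ∧
          {z : ℂ | ∑ p ∈ Finset.HasAntidiagonal.antidiagonal m,
            PlaneCurve.affineCoeff e F (2 * p.1) p.2 * z ^ p.2 = 0}.encard = m)) ∧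
    (∃ L : Submodule ℂ (PlaneCurve.Forms 6), Module.finrank ℂ L = 15 + 1 ∧
      ∃ U : Set (Projectivization ℂ (PlaneCurve.Forms 6)), PlaneCurve.IsZariskiOpen U ∧
        PlaneCurve.t3Sextics A Λ = PlaneCurve.projSubspace L ∩ U ∧
        (PlaneCurve.t3Sextics A Λ).Nonempty) := by
  obtain ⟨e, he⟩ := exists_isAdapted hΛ hA
  refine ⟨fun e' he' m d _ hd F hF => hasTmSingularity_iff he' hd hF, weightedSextics e,
    finrank_weightedSextics e, _, ?_, t3Sextics_eq he, t3Sextics_nonempty he⟩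
  exact isZariskiOpen_exists_det_ne_zero
    (fun k : Σ N, coxExponents N → Fin 4 → MvPolynomial (Fin 4) ℂ => coxExponents k.1)
    fun k => strictMatrixForm e k.1 k.2
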